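/- Let $V=\{x_1,\dots,x_n\}$ be a finite set and let $\Delta$ be a simplicial complex with vertex set $V$, i.e. a collection of subsets of $V$ that is closed under taking subsets and contains every $\{x_i\}$. The facets of $\Delta$ are its maximal faces. A \emph{subcomplex} of $\Delta$ means a simplicial complex whose set of facets is a subset of the set of facets of $\Delta$. A facet $F$ of a simplicial complex $\Gamma$ is a \emph{leaf} of $\Gamma$ if either $F$ is the only facet of $\Gamma$, or there is a facet $G\neq F$ of $\Gamma$ such that $F\cap F'\subseteq F\cap G$ for every facet $F'\neq F$ of $\Gamma$. The complex $\Delta$ is a \emph{tree} if it is connected and every nonempty subcomplex of $\Delta$ has a leaf. \textbf{Theorem.} Let $\Delta$ be a tree on the vertex set $\{x_1,\dots,x_n\}$ with facets $F_1,\dots,F_q$, let $k$ be a field, and let $R$ be the localization of the polynomial ring $k[x_1,\dots,x_n]$ at the maximal ideal $(x_1,\dots,x_n)$; it is a local ring of dimension $n$. Let $M_j=\prod_{x_i\in F_j}x_i$, so that $M_1,\dots,M_q$ generate the facet ideal $\mathcal F(\Delta)R$, and let $\mathbb K$ be the Koszul complex of $M_1,\dots,M_q$ over $R$. Then $\mathcal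 F(\Delta)R$ satisfies sliding depth with respect to these generators, that is, $$\operatorname{depth} H_i(\mathbb K)\ \ge\ n-q+i\qquad\text{for all } i .$$ Here the depth of a module is the supremum of the lengths of regular sequences on it in the maximal ideal of $R$, and the zero module has depth $\infty$. -/

import Mathlib

open CategoryTheory

/-! ### Simplicial complexes, facets, leaves, trees -/

namespace PreAbstractSimplicialComplex

variable {V : Type*}

/-- The facets of a simplicial complex: its faces that are maximal under inclusion.
(In Mathlib the faces of a complex are its nonempty faces; the empty face is left implicit.) -/
def facets (Δ : PreAbstractSimplicialComplex V) : Set (Finset V) :=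
  {F | Maximal (· ∈ Δ) F}

/-- A subcomplex of `Δ`, in the sense used for simplicial trees: a simplicial complex all of whose
facets are facets of `Δ`. Its vertices may form a proper subset of those of `Δ`. -/
def IsSubcomplex (Γ Δ : PreAbstractSimplicialComplex V) : Prop :=
  Γ.facets ⊆ Δ.facets

/-- A facet `F` of `Γ` is a leaf if it is the only facet, or if there is another facet `G` such that
`F ∩ F' ⊆ F ∩ G` for all facets `F' ≠ F`. -/
def IsLeaf (Γ : PreAbstractSimplicialComplex V) (F : Finset V) : Prop :=
  F ∈ Γ.facets ∧
    (Γ.facets = {F} ∨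
      ∃ G ∈ Γ.facets, G ≠ F ∧
        ∀ F' ∈ Γ.facets, F' ≠ F → (F : Set V) ∩ F' ⊆ (F : Set V) ∩ G)

end PreAbstractSimplicialComplex

namespace AbstractSimplicialComplex

variable {V : Type*}

/-- The graph formed by the vertices and the edges of a simplicial complex. -/
def edgeGraph (Δ : AbstractSimplicialComplex V) : SimpleGraph V where
  Adj u v := u ≠ v ∧ ∃ F ∈ Δ, u ∈ F ∧ v ∈ F
  symm := ⟨fun _ _ ⟨h, F, hF, hu, hv⟩ => ⟨h.symm, F, hF, hv, hu⟩⟩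
  loopless := ⟨fun _ h => h.1 rfl⟩

/-- A simplicial complex is connected if it has a vertex and any two of its vertices
are joined by a path of edges. -/
def IsConnected (Δ : AbstractSimplicialComplex V) : Prop :=
  Δ.edgeGraph.Connected

/-- A (simplicial) tree: a connected simplicial complex each of whose nonempty subcomplexes
has a leaf. -/
def IsTree (Δ : AbstractSimplicialComplex V) : Prop :=
  Δ.IsConnected ∧
    ∀ Γ : PreAbstractSimplicialComplex V,
      Γ.IsSubcomplex Δ.toPreAbstractSimplicialComplex → Γ ≠ ⊥ → ∃ F, Γ.IsLeaf F

end AbstractSimplicialComplex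

/-! ### The Koszul complex, depth, sliding depth -/

namespace Koszul

variable {R : Type*} [CommRing R] {M : Type*} [AddCommGroup M] [Module R M]

/-- Contraction with a linear form `f` lowers the degree in the exterior algebra by one. -/
theorem contractLeft_mem (f : Module.Dual R M) (i : ℕ) (x : ExteriorAlgebra R M)
    (hx : x ∈ ⋀[R]^(i + 1) M) :
    CliffordAlgebra.contractLeft (Q := (0 : QuadraticForm R M)) f x ∈ ⋀[R]^i M := by
  induction i generalizing x with
  | zero =>
    rw [ExteriorAlgebra.exteriorPower, zero_add, pow_one] at hx
    obtain ⟨m, rfl⟩ := hx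
    rw [ExteriorAlgebra.exteriorPower, pow_zero]
    exact Submodule.mem_one.2
      ⟨f m, (CliffordAlgebra.contractLeft_ι (Q := (0 : QuadraticForm R M)) f m).symm⟩
  | succ i ih =>
    rw [ExteriorAlgebra.exteriorPower, pow_succ'] at hx
    refine Submodule.mul_induction_on hx ?_ ?_
    · rintro _ ⟨m, rfl⟩ y hy
      have h1 := CliffordAlgebra.contractLeft_ι_mul (Q := (0 : QuadraticForm R M)) (d := f) m y
      have h2 : ExteriorAlgebra.ι R m *
          CliffordAlgebra.contractLeft (Q := (0 : QuadraticForm R M)) f y ∈ ⋀[R]^(i + 1) M := by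
        rw [ExteriorAlgebra.exteriorPower, pow_succ']
        exact Submodule.mul_mem_mul ⟨m, rfl⟩ (ih y hy)
      have h3 := Submodule.sub_mem _ (Submodule.smul_mem _ (f m) hy) h2
      exact h1 ▸ h3
    · intro y z hy hz
      rw [map_add]
      exact Submodule.add_mem _ hy hz

/-- The differential `⋀^(i+1) M → ⋀^i M` of the Koszul complex of a linear form `f : M → R`:
`m₀ ∧ ⋯ ∧ mᵢ ↦ ∑ⱼ (-1)^j f(mⱼ) m₀ ∧ ⋯ ∧ m̂ⱼ ∧ ⋯ ∧ mᵢ`, i.e. contraction with `f`. -/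
noncomputable def differential (f : Module.Dual R M) (i : ℕ) : ⋀[R]^(i + 1) M →ₗ[R] ⋀[R]^i M :=
  (CliffordAlgebra.contractLeft (Q := (0 : QuadraticForm R M)) f).restrict (contractLeft_mem f i)

theorem differential_differential (f : Module.Dual R M) (i : ℕ) (x : ⋀[R]^(i + 1 + 1) M) :
    differential f i (differential f (i + 1) x) = 0 :=
  Subtype.ext (CliffordAlgebra.contractLeft_contractLeft (Q := (0 : QuadraticForm R M)) f x.1)

end Koszul

/-- The Koszul complex of a family `a : ι → R`: the exterior powers of the free module `R^ι`
with the contraction by the linear form that sends the `j`-th basis vector to `a j`. -/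
noncomputable def koszulComplex {R : Type*} [CommRing R] {ι : Type*} (a : ι → R) :
    ChainComplex (ModuleCat R) ℕ :=
  ChainComplex.of (fun i => ModuleCat.of R (⋀[R]^i (ι →₀ R)))
    (fun i => ModuleCat.ofHom (Koszul.differential (Finsupp.linearCombination R a) i))
    (fun i => by
      refine ModuleCat.hom_ext (LinearMap.ext fun x => ?_)
      exact Koszul.differential_differential (Finsupp.linearCombination R a) i x)

/-- The depth of a module over a local ring: the supremum of the lengths of the `M`-regular
sequences in the maximal ideal. A nonzero finitely generated module never equals `(rs) M`, so only
the condition that each element is a nonzerodivisor modulo the previous ones is imposed; with this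
the depth of the zero module is `∞`, as usual. -/
noncomputable def moduleDepth (R : Type*) [CommRing R] [IsLocalRing R]
    (M : Type*) [AddCommGroup M] [Module R M] : ℕ∞ :=
  ⨆ (rs : List R) (_ : ∀ r ∈ rs, r ∈ IsLocalRing.maximalIdeal R)
    (_ : RingTheory.Sequence.IsWeaklyRegular M rs), (rs.length : ℕ∞)

/-- The ideal `I` of the local ring `R`, of dimension `n`, satisfies sliding depth with respect to
the generators `a 1, …, a q`: `depth H_i(K) ≥ n - q + i` for all `i`, where `K` is the
Koszul complex of `a`. The inequality is written as `n + i ≤ depth H_i(K) + q`. -/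
def SlidingDepth {R : Type*} [CommRing R] [IsLocalRing R] {ι : Type*} [Finite ι]
    (I : Ideal R) (a : ι → R) : Prop :=
  Ideal.span (Set.range a) = I ∧
    ∀ i : ℕ, ringKrullDim R + i ≤
      (moduleDepth R ((koszulComplex a).homology i) : WithBot ℕ∞) + (Nat.card ι : ℕ)

/-! ### The local polynomial ring and the facet ideal -/

section PolynomialRing

variable (V k : Type*) [Field k]

open MvPolynomial

theorem idealOfVars_eq_ker : idealOfVars V k = RingHom.ker (constantCoeff (R := k) (σ := V)) := by
  ext p
  have h := mem_pow_idealOfVars_iff' (σ := V) (R := k) 1 p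
  rw [pow_one] at h
  rw [h, RingHom.mem_ker, constantCoeff_eq]
  constructor
  · intro hp
    exact hp 0 (by simp)
  · intro hp x hx
    obtain rfl : x = 0 := by
      rw [← Finsupp.degree_eq_zero_iff]
      omega
    exact hp

instance idealOfVars_isPrime : (idealOfVars V k).IsPrime :=
  idealOfVars_eq_ker V k ▸ RingHom.ker_isPrime _

/-- The polynomial ring `k[V]` localized at the maximal ideal generated by the variables. -/
abbrev LocalPolynomialRing : Type _ :=
  Localization.AtPrime (idealOfVars V k)

/-- The local polynomial ring has dimension `n`, the number of variables. -/
theorem ringKrullDim_localPolynomialRing [Finite V] :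
    ringKrullDim (LocalPolynomialRing V k) = Nat.card V := by
  classical
  have := Fintype.ofFinite V
  rw [IsLocalization.AtPrime.ringKrullDim_eq_height (idealOfVars V k)]
  refine le_antisymm ?_ ?_
  · refine (Ideal.height_le_ringKrullDim_of_ne_top (idealOfVars_isPrime V k).ne_top).trans ?_
    simp
  · let e : Finset V → MvPolynomial V k →ₐ[k] MvPolynomial V k :=
      fun s => aeval fun i => if i ∈ s then 0 else X i
    have hcomp : ∀ s t, s ⊆ t → (e t).comp (e s) = e t := by
      intro s t hst
      ext i : 1
      by_cases hs : i ∈ s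
      · simp [e, hs, hst hs]
      · simp [e, hs]
    have key : ∀ s : Finset V, (s.card : ℕ∞) ≤ (RingHom.ker (e s)).height := by
      intro s
      induction s using Finset.induction_on with
      | empty => simp
      | insert v s hv ih =>
        have hlt : RingHom.ker (e s) < RingHom.ker (e (insert v s)) := by
          refine lt_of_le_not_ge ?_ ?_
          · intro p hp
            rw [RingHom.mem_ker] at hp ⊢
            rw [← hcomp s _ (Finset.subset_insert v s), AlgHom.comp_apply, hp, map_zero]
          · intro h
            have h1 : (X v : MvPolynomial V k) ∈ RingHom.ker (e (insert v s)) := by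
              simp [RingHom.mem_ker, e]
            have h2 := h h1
            simp [RingHom.mem_ker, e, hv] at h2
        have : (RingHom.ker (e s)).IsPrime := RingHom.ker_isPrime _
        have : (RingHom.ker (e (insert v s))).IsPrime := RingHom.ker_isPrime _
        rw [Finset.card_insert_of_notMem hv, Nat.cast_add, Nat.cast_one]
        exact (by gcongr : _ ≤ _).trans (Ideal.height_add_one_le_of_lt_of_isPrime hlt)
    have htop : RingHom.ker (e Finset.univ) ≤ idealOfVars V k := by
      intro p hp
      rw [idealOfVars_eq_ker, RingHom.mem_ker]
      rw [RingHom.mem_ker] at hp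
      have h0 : (constantCoeff (R := k) (σ := V)).comp (e Finset.univ).toRingHom
          = constantCoeff := by
        apply MvPolynomial.ringHom_ext
        · intro r
          simp [e]
        · intro i
          simp [e]
      rw [← h0]
      simp [hp]
    have := (key Finset.univ).trans (Ideal.height_mono htop)
    rw [Nat.card_eq_fintype_card, ← Finset.card_univ]
    exact_mod_cast this

variable {V}

/-- The square-free monomial `∏_{v ∈ F} x_v`. -/
noncomputable def squarefreeMonomial (F : Finset V) : MvPolynomial V k :=
  ∏ v ∈ F, X v

/-- The facet ideal of a simplicial complex: the ideal of `k[V]` generated by the square-free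
monomials that correspond to the facets. -/
noncomputable def facetIdeal (Δ : AbstractSimplicialComplex V) : Ideal (MvPolynomial V k) :=
  Ideal.span (squarefreeMonomial k '' Δ.facets)

/-- The monomial generators of the facet ideal in the local ring, one for each facet. -/
noncomputable def facetGenerators (Δ : AbstractSimplicialComplex V) (F : Δ.facets) :
    LocalPolynomialRing V k :=
  algebraMap (MvPolynomial V k) (LocalPolynomialRing V k) (squarefreeMonomial k F.1)

end PolynomialRing

/-! The proof is an induction on the number of generators, for any finite family of finite sets in
which every nonempty subfamily has a leaf. Let `F` be a leaf with joint `G`, and write `M_F = m x`,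
`M_G = m y`, where `m` is the monomial of `F ∩ G`. No variable of `x` occurs in a generator other
than `M_F`, so `x` is regular on the Koszul homology of the remaining generators. Two smaller
families satisfy the induction hypothesis: the one without `F`, with generators `(g, m y)`, and the
one in which moreover `G` is replaced by `F ∩ G`, with generators `(g, m)`. The latter has leaves
because its pairwise intersections are those of the family without `G` (`HasLeaves.contractLeaf`).
Put `H_i = H_i(g, m y)`. Adjoining a generator `c` gives short exact sequences `0 → H_i / c H_i →
H_i(g, m y, c) → ker (c on H_{i-1}) → 0`. For `c = m` the middle term is known: `(g, m y, m)` has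
the Koszul complex of `(g, m, 0)`, which inherits sliding depth from `(g, m)`. Induction on `i` then
bounds the depths of `H_i / m H_i`, of `m H_i` and of the kernel of `m` (`Sliding.quotient_of_mul`).
Since `x` is regular, `m x` has the same kernel as `m` and an isomorphic image, and the sequences
for `c = m x` give the claim (`Sliding.adjoin_mul`). Depth is handled as vanishing of `Ext^i(κ, -)`,
so that the depth inequalities are read off from long exact sequences; only at the end is a regular
sequence extracted (`DepthGE.le_moduleDepth`). -/

/-! ### Depth by vanishing of `Ext` -/

section ExtDepth

universe w

open CategoryTheory.Abelian

variable {R : Type w} [CommRing R] [IsLocalRing R]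

/-- `DepthGE R M t` says that `Ext^i(κ, M) = 0` for all `i < t`, where `κ` is the residue field. For
finitely generated modules over Noetherian local rings this means that `M` has depth at least `t`. -/
def DepthGE (R : Type w) [CommRing R] [IsLocalRing R] (M : Type w) [AddCommGroup M] [Module R M]
    (t : ℕ) : Prop :=
  ∀ i < t, Subsingleton
    (Ext (ModuleCat.of R (R ⧸ IsLocalRing.maximalIdeal R)) (ModuleCat.of R M) i)

namespace DepthGE

variable {A B C : Type w} [AddCommGroup A] [Module R A] [AddCommGroup B] [Module R B]
  [AddCommGroup C] [Module R C]

theorem mono {s t : ℕ} (h : DepthGE R A t) (hst : s ≤ t) : DepthGE R A s :=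
  fun i hi => h i (hi.trans_le hst)

theorem zero : DepthGE R A 0 := fun _ hi => absurd hi (Nat.not_lt_zero _)

theorem of_subsingleton [Subsingleton A] (t : ℕ) : DepthGE R A t := by
  intro i _
  have h : (𝟙 (ModuleCat.of R A)) = 0 := (ModuleCat.isZero_of_subsingleton _).eq_of_src _ _
  refine ⟨fun a b => ?_⟩
  rw [← Ext.comp_mk₀_id a, ← Ext.comp_mk₀_id b, h, Ext.mk₀_zero, Ext.comp_zero, Ext.comp_zero]

variable {f : A →ₗ[R] B} {g : B →ₗ[R] C}

omit [IsLocalRing R] in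
theorem shortExact_of_exact (hf : Function.Injective f) (hfg : Function.Exact f g)
    (hg : Function.Surjective g) :
    (ShortComplex.mk (ModuleCat.ofHom f) (ModuleCat.ofHom g)
      (ModuleCat.hom_ext hfg.linearMap_comp_eq_zero)).ShortExact :=
  ModuleCat.shortComplex_shortExact _ hfg hf hg

theorem middle (hf : Function.Injective f) (hfg : Function.Exact f g)
    (hg : Function.Surjective g) {t : ℕ} (hA : DepthGE R A t) (hC : DepthGE R C t) :
    DepthGE R B t := by
  intro i hi
  have hS := shortExact_of_exact hf hfg hg
  have := hA i hi
  have := hC i hi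
  refine subsingleton_of_forall_eq 0 fun x => ?_
  obtain ⟨y, rfl⟩ := Ext.covariant_sequence_exact₂ _ hS x (Subsingleton.elim (α :=
    Ext (ModuleCat.of R (R ⧸ IsLocalRing.maximalIdeal R)) (ModuleCat.of R C) i) _ _)
  rw [Subsingleton.elim (α :=
    Ext (ModuleCat.of R (R ⧸ IsLocalRing.maximalIdeal R)) (ModuleCat.of R A) i) y 0, Ext.zero_comp]

/-- The connecting map goes from `Ext^i(κ, C)` to `Ext^(i+1)(κ, A)`, which is why `C` may have depth
one less than `A`. -/
theorem left (hf : Function.Injective f) (hfg : Function.Exact f g)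
    (hg : Function.Surjective g) {t s : ℕ} (hB : DepthGE R B t) (hC : DepthGE R C s)
    (hts : t ≤ s + 1) : DepthGE R A t := by
  intro i hi
  have hS := shortExact_of_exact hf hfg hg
  have := hB i hi
  refine subsingleton_of_forall_eq 0 fun x => ?_
  have hx := Subsingleton.elim (α :=
    Ext (ModuleCat.of R (R ⧸ IsLocalRing.maximalIdeal R)) (ModuleCat.of R B) i)
    (x.comp (Ext.mk₀ (ModuleCat.ofHom f)) (add_zero i)) 0
  cases i with
  | zero =>
    have := (ModuleCat.mono_iff_injective (ModuleCat.ofHom f)).2 hf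
    exact Ext.postcomp_mk₀_injective_of_mono _ (ModuleCat.ofHom f) (by simpa using! hx)
  | succ i =>
    have := hC i (by omega)
    obtain ⟨y, rfl⟩ := Ext.covariant_sequence_exact₁ _ hS x hx rfl
    rw [Subsingleton.elim (α :=
      Ext (ModuleCat.of R (R ⧸ IsLocalRing.maximalIdeal R)) (ModuleCat.of R C) i) y 0,
      Ext.zero_comp]

/-- `Ext^i(κ, C)` lies between `Ext^i(κ, B)` and `Ext^(i+1)(κ, A)`. The subtraction `s - 1` is
truncated; for `s = 0` it forces `t = 0`, where nothing is claimed. -/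
theorem right (hf : Function.Injective f) (hfg : Function.Exact f g)
    (hg : Function.Surjective g) {t s : ℕ} (hA : DepthGE R A s) (hB : DepthGE R B t)
    (hts : t ≤ s - 1) : DepthGE R C t := by
  intro i hi
  have hS := shortExact_of_exact hf hfg hg
  have := hA (i + 1) (by omega)
  have := hB i hi
  refine subsingleton_of_forall_eq 0 fun x => ?_
  obtain ⟨y, rfl⟩ := Ext.covariant_sequence_exact₃ _ hS x rfl (Subsingleton.elim (α :=
    Ext (ModuleCat.of R (R ⧸ IsLocalRing.maximalIdeal R)) (ModuleCat.of R A) (i + 1)) _ _)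
  rw [Subsingleton.elim (α :=
    Ext (ModuleCat.of R (R ⧸ IsLocalRing.maximalIdeal R)) (ModuleCat.of R B) i) y 0, Ext.zero_comp]

theorem of_linearEquiv (e : A ≃ₗ[R] B) {t : ℕ} (hA : DepthGE R A t) : DepthGE R B t :=
  middle (f := e.toLinearMap) (g := (0 : B →ₗ[R] PUnit.{w + 1})) e.injective
    (fun x => ⟨fun _ => ⟨e.symm x, e.apply_symm_apply x⟩, fun _ => rfl⟩)
    (fun _ => ⟨0, Subsingleton.elim _ _⟩) hA (of_subsingleton t)

/-- If multiplication by an element of the maximal ideal is injective on `A`, with cokernel of depth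
at least `t`, then `A` has depth at least `t + 1`. -/
theorem succ_of_regular {x : R} (hx : x ∈ IsLocalRing.maximalIdeal R)
    {f : A →ₗ[R] A} (hfx : ∀ a, f a = x • a) (hf : Function.Injective f)
    {g : A →ₗ[R] C} (hfg : Function.Exact f g) (hg : Function.Surjective g)
    {t : ℕ} (hC : DepthGE R C t) : DepthGE R A (t + 1) := by
  have hmem : x ∈ Module.annihilator R (R ⧸ IsLocalRing.maximalIdeal R) := by
    rwa [Ideal.annihilator_quotient]
  have hfm : ModuleCat.ofHom f = x • 𝟙 (ModuleCat.of R A) := by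
    refine ModuleCat.hom_ext (LinearMap.ext fun a => hfx a)
  have hS := shortExact_of_exact hf hfg hg
  intro i hi
  refine subsingleton_of_forall_eq 0 fun y => ?_
  -- Since `x` annihilates `κ`, multiplication by `x` on `A` induces zero on `Ext^i(κ, A)`.
  have hy : y.comp (Ext.mk₀ (ModuleCat.ofHom f)) (add_zero i) = 0 := by
    have := Ext.postcomp_smul_id_eq_zero_of_mem_annihilator
      (M := ModuleCat.of R A) (N := ModuleCat.of R (R ⧸ IsLocalRing.maximalIdeal R)) hmem i
    rw [hfm]
    exact congr($(this).hom y)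
  cases i with
  | zero =>
    have := (ModuleCat.mono_iff_injective (ModuleCat.ofHom f)).2 hf
    exact Ext.postcomp_mk₀_injective_of_mono _ (ModuleCat.ofHom f) (by simpa using! hy)
  | succ i =>
    have := hC i (by omega)
    obtain ⟨z, rfl⟩ := Ext.covariant_sequence_exact₁ _ hS y hy rfl
    rw [Subsingleton.elim (α :=
      Ext (ModuleCat.of R (R ⧸ IsLocalRing.maximalIdeal R)) (ModuleCat.of R C) i) z 0,
      Ext.zero_comp]

/-- The passage back from `Ext` to regular sequences. Only this direction is needed, since all lower
bounds are produced in terms of `Ext`. -/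
theorem le_moduleDepth [IsNoetherianRing R] [Module.Finite R A] {t : ℕ} (h : DepthGE R A t) :
    (t : ℕ∞) ≤ moduleDepth R A := by
  suffices ∃ rs : List R, rs.length = t ∧ (∀ r ∈ rs, r ∈ IsLocalRing.maximalIdeal R) ∧
      RingTheory.Sequence.IsWeaklyRegular A rs by
    obtain ⟨rs, rfl, h1, h2⟩ := this
    exact le_iSup_of_le rs (le_iSup_of_le h1 (le_iSup_of_le h2 le_rfl))
  -- The `Ext` criterion needs `𝔪 A ≠ A`, which is Nakayama for `A ≠ 0`. On the zero module any
  -- sequence is weakly regular, so `t` zeros serve.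
  cases subsingleton_or_nontrivial A with
  | inl hA =>
    refine ⟨List.replicate t 0, List.length_replicate, fun r hr => ?_, ?_⟩
    · rw [List.eq_of_mem_replicate hr]
      exact zero_mem _
    · refine ⟨fun i hi => ?_⟩
      exact fun a b _ => Subsingleton.elim a b
  | inr hA =>
    have hlt : IsLocalRing.maximalIdeal R • (⊤ : Submodule R A) < ⊤ := by
      refine lt_top_iff_ne_top.2 fun h => ?_
      exact Submodule.top_ne_ideal_smul_of_le_jacobson_annihilator
        (IsLocalRing.maximalIdeal_le_jacobson _) h.symm
    obtain ⟨rs, h1, h2, h3⟩ := ModuleCat.exists_isRegular_of_exists_subsingleton_ext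
      (IsLocalRing.maximalIdeal R) t (ModuleCat.of R A) hlt
      (ModuleCat.of R (R ⧸ IsLocalRing.maximalIdeal R))
      (by
        change Module.support R (R ⧸ IsLocalRing.maximalIdeal R) = _
        rw [Module.support_eq_zeroLocus, Ideal.annihilator_quotient]) h
    exact ⟨rs, h1, h2, h3.toIsWeaklyRegular⟩

end DepthGE

end ExtDepth

/-! ### Koszul homology inside the exterior algebra -/

namespace Koszul

section Contraction

variable {R : Type*} [CommRing R] {M N : Type*} [AddCommGroup M] [Module R M]
  [AddCommGroup N] [Module R N]

/-- Contraction with a linear form, as an endomorphism of the exterior algebra. -/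
noncomputable abbrev contraction (f : Module.Dual R M) :
    ExteriorAlgebra R M →ₗ[R] ExteriorAlgebra R M :=
  CliffordAlgebra.contractLeft (Q := (0 : QuadraticForm R M)) f

theorem contraction_ι_mul (f : Module.Dual R M) (m : M) (x : ExteriorAlgebra R M) :
    contraction f (ExteriorAlgebra.ι R m * x) = f m • x - ExteriorAlgebra.ι R m * contraction f x :=
  CliffordAlgebra.contractLeft_ι_mul (Q := (0 : QuadraticForm R M)) (d := f) m x

theorem contraction_algebraMap (f : Module.Dual R M) (r : R) :
    contraction f (algebraMap R (ExteriorAlgebra R M) r) = 0 :=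
  CliffordAlgebra.contractLeft_algebraMap (Q := (0 : QuadraticForm R M)) f r

theorem contraction_eq_zero (f : Module.Dual R M) {x : ExteriorAlgebra R M}
    (hx : x ∈ ⋀[R]^0 M) : contraction f x = 0 := by
  rw [ExteriorAlgebra.exteriorPower, pow_zero] at hx
  obtain ⟨r, rfl⟩ := Submodule.mem_one.1 hx
  exact contraction_algebraMap f r

theorem left_induction {C : ExteriorAlgebra R M → Prop}
    (algebraMap : ∀ r, C (algebraMap R (ExteriorAlgebra R M) r))
    (add : ∀ x y, C x → C y → C (x + y)) (ι_mul : ∀ x m, C x → C (ExteriorAlgebra.ι R m * x))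
    (x : ExteriorAlgebra R M) : C x :=
  CliffordAlgebra.left_induction (0 : QuadraticForm R M) algebraMap add ι_mul x

theorem map_mem (φ : M →ₗ[R] N) {i : ℕ} {x : ExteriorAlgebra R M} (hx : x ∈ ⋀[R]^i M) :
    ExteriorAlgebra.map φ x ∈ ⋀[R]^i N := by
  have h : Submodule.map (ExteriorAlgebra.map φ).toLinearMap (⋀[R]^i M) ≤ ⋀[R]^i N := by
    rw [ExteriorAlgebra.exteriorPower, ExteriorAlgebra.exteriorPower, Submodule.map_pow]
    refine pow_le_pow_left' ?_ i
    rintro _ ⟨_, ⟨m, rfl⟩, rfl⟩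
    exact ⟨φ m, (ExteriorAlgebra.map_apply_ι φ m).symm⟩
  exact h ⟨x, hx, rfl⟩

theorem ι_mul_mem (m : M) {i : ℕ} {x : ExteriorAlgebra R M} (hx : x ∈ ⋀[R]^i M) :
    ExteriorAlgebra.ι R m * x ∈ ⋀[R]^(i + 1) M := by
  rw [ExteriorAlgebra.exteriorPower, pow_succ']
  exact Submodule.mul_mem_mul ⟨m, rfl⟩ hx

/-- Naturality of the Koszul differential: a linear map compatible with the linear forms induces a
chain map. -/
theorem contraction_map (φ : M →ₗ[R] N) (f : Module.Dual R N) (x : ExteriorAlgebra R M) :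
    contraction f (ExteriorAlgebra.map φ x) = ExteriorAlgebra.map φ (contraction (f ∘ₗ φ) x) := by
  induction x using left_induction with
  | algebraMap r =>
    rw [AlgHom.commutes, contraction_algebraMap, contraction_algebraMap, map_zero]
  | add x y hx hy => simp only [map_add, hx, hy]
  | ι_mul x m hx =>
    rw [map_mul, ExteriorAlgebra.map_apply_ι, contraction_ι_mul, contraction_ι_mul, hx, map_sub,
      map_mul, ExteriorAlgebra.map_apply_ι, map_smul]
    rfl

end Contraction

/-! ### The Koszul complex after adjunction of one generator -/

section AdjoinGenerator

variable {R : Type*} [CommRing R] {M : Type*} [AddCommGroup M] [Module R M]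

/-- The linear form on `M × R` that extends `g` and takes the value `c` at `(0, 1)`. -/
def adjoin (g : Module.Dual R M) (c : R) : Module.Dual R (M × R) :=
  LinearMap.coprod g (LinearMap.toSpanSingleton R R c)

theorem adjoin_comp_inl (g : Module.Dual R M) (c : R) :
    adjoin g c ∘ₗ LinearMap.inl R M R = g :=
  LinearMap.coprod_inl _ _

theorem adjoin_apply (g : Module.Dual R M) (c : R) (p : M × R) :
    adjoin g c p = g p.1 + p.2 * c := rfl

/-- The isomorphism `⋀ M × ⋀ M → ⋀ (M × R)`, `(u, v) ↦ u + e ∧ v` with `e = (0, 1)`. -/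
noncomputable def join (u v : ExteriorAlgebra R M) : ExteriorAlgebra R (M × R) :=
  ExteriorAlgebra.map (LinearMap.inl R M R) u +
    ExteriorAlgebra.ι R ((0, 1) : M × R) * ExteriorAlgebra.map (LinearMap.inl R M R) v

/-- The first component of the inverse of `join`. -/
noncomputable def part₀ : ExteriorAlgebra R (M × R) →ₗ[R] ExteriorAlgebra R M :=
  (ExteriorAlgebra.map (LinearMap.fst R M R)).toLinearMap

/-- The second component of the inverse of `join`. -/
noncomputable def part₁ : ExteriorAlgebra R (M × R) →ₗ[R] ExteriorAlgebra R M :=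
  part₀ ∘ₗ contraction (LinearMap.snd R M R)

theorem map_fst_map_inl (u : ExteriorAlgebra R M) :
    ExteriorAlgebra.map (LinearMap.fst R M R) (ExteriorAlgebra.map (LinearMap.inl R M R) u) = u := by
  have h : (ExteriorAlgebra.map (LinearMap.fst R M R)).comp
      (ExteriorAlgebra.map (LinearMap.inl R M R)) = AlgHom.id R _ := by
    rw [ExteriorAlgebra.map_comp_map, LinearMap.fst_comp_inl, ExteriorAlgebra.map_id]
  exact congr($h u)

theorem contraction_snd_map_inl (u : ExteriorAlgebra R M) :
    contraction (LinearMap.snd R M R) (ExteriorAlgebra.map (LinearMap.inl R M R) u) = 0 := by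
  rw [contraction_map, LinearMap.snd_comp_inl]
  simp [contraction]

theorem part₀_join (u v : ExteriorAlgebra R M) : part₀ (join u v) = u := by
  simp [part₀, join, map_fst_map_inl]

theorem part₁_join (u v : ExteriorAlgebra R M) : part₁ (join u v) = v := by
  rw [part₁, LinearMap.comp_apply, join, map_add, contraction_snd_map_inl, contraction_ι_mul,
    contraction_snd_map_inl]
  simp [part₀, map_fst_map_inl]

/-- Write `e = (0, 1)`. Multiplication by a vector of `M` respects the decomposition up to the sign
from moving it past `e`, and multiplication by `e` kills the second component because `e ∧ e = 0`.
-/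
theorem join_part (w : ExteriorAlgebra R (M × R)) : join (part₀ w) (part₁ w) = w := by
  simp only [join, part₁, part₀, LinearMap.comp_apply, AlgHom.toLinearMap_apply]
  induction w using left_induction with
  | algebraMap r => simp
  | add x y hx hy =>
    nth_rewrite 3 [← hx]
    nth_rewrite 3 [← hy]
    simp only [map_add, mul_add]
    abel
  | ι_mul x m hx =>
    have hm : m = LinearMap.inl R M R m.1 + m.2 • ((0, 1) : M × R) := by
      ext <;> simp
    have h1 : ExteriorAlgebra.ι R m = ExteriorAlgebra.ι R (LinearMap.inl R M R m.1) +
        m.2 • ExteriorAlgebra.ι R ((0, 1) : M × R) := by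
      conv_lhs => rw [hm]
      rw [map_add, map_smul]
    have h2 : ExteriorAlgebra.ι R ((0, 1) : M × R) * ExteriorAlgebra.ι R (LinearMap.inl R M R m.1) =
        - (ExteriorAlgebra.ι R (LinearMap.inl R M R m.1) * ExteriorAlgebra.ι R ((0, 1) : M × R)) :=
      eq_neg_of_add_eq_zero_left (ExteriorAlgebra.ι_add_mul_swap _ _)
    have h3 : ExteriorAlgebra.ι R ((0, 1) : M × R) * ExteriorAlgebra.ι R ((0, 1) : M × R) = 0 :=
      ExteriorAlgebra.ι_sq_zero _
    rw [contraction_ι_mul]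
    conv_rhs => rw [← hx, h1]
    simp only [map_mul, map_sub, ExteriorAlgebra.map_apply_ι, map_smul, LinearMap.fst_apply,
      LinearMap.snd_apply, mul_sub, add_mul, mul_add, smul_mul_assoc, mul_smul_comm]
    rw [← mul_assoc (ExteriorAlgebra.ι R ((0, 1) : M × R)) (ExteriorAlgebra.ι R ((0, 1) : M × R)), h3,
      ← mul_assoc (ExteriorAlgebra.ι R ((0, 1) : M × R)), h2]
    simp only [neg_mul, mul_assoc, zero_mul, smul_zero]
    abel

/-- In the coordinates `(u, v)` the new differential is that of the mapping cone of multiplication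
by `c`. The sign comes from passing the contraction across `e`. -/
theorem contraction_adjoin_join (g : Module.Dual R M) (c : R) (u v : ExteriorAlgebra R M) :
    contraction (adjoin g c) (join u v) = join (contraction g u + c • v) (-contraction g v) := by
  simp only [join, map_add, contraction_ι_mul, contraction_map, adjoin_comp_inl, adjoin_apply, map_zero, zero_add,
    one_mul, map_smul, map_neg, mul_neg]
  abel

theorem part₀_contraction (g : Module.Dual R M) (c : R) (w : ExteriorAlgebra R (M × R)) :
    part₀ (contraction (adjoin g c) w) = contraction g (part₀ w) + c • part₁ w := by
  conv_lhs => rw [← join_part w, contraction_adjoin_join, part₀_join]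

theorem part₁_contraction (g : Module.Dual R M) (c : R) (w : ExteriorAlgebra R (M × R)) :
    part₁ (contraction (adjoin g c) w) = - contraction g (part₁ w) := by
  conv_lhs => rw [← join_part w, contraction_adjoin_join, part₁_join]

theorem join_mem {u v : ExteriorAlgebra R M} {i : ℕ} (hu : u ∈ ⋀[R]^(i + 1) M)
    (hv : v ∈ ⋀[R]^i M) : join u v ∈ ⋀[R]^(i + 1) (M × R) :=
  add_mem (map_mem _ hu) (ι_mul_mem _ (map_mem _ hv))

theorem join_zero_mem {u : ExteriorAlgebra R M} {i : ℕ} (hu : u ∈ ⋀[R]^i M) :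
    join u 0 ∈ ⋀[R]^i (M × R) := by
  rw [join, map_zero, mul_zero, add_zero]
  exact map_mem _ hu

theorem part₀_mem {w : ExteriorAlgebra R (M × R)} {i : ℕ} (hw : w ∈ ⋀[R]^i (M × R)) :
    part₀ w ∈ ⋀[R]^i M :=
  map_mem _ hw

theorem part₁_mem {w : ExteriorAlgebra R (M × R)} {i : ℕ} (hw : w ∈ ⋀[R]^(i + 1) (M × R)) :
    part₁ w ∈ ⋀[R]^i M :=
  map_mem _ (contractLeft_mem _ _ _ hw)

theorem part₁_eq_zero {w : ExteriorAlgebra R (M × R)} (hw : w ∈ ⋀[R]^0 (M × R)) :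
    part₁ w = 0 := by
  rw [part₁, LinearMap.comp_apply, contraction_eq_zero _ hw, map_zero]

end AdjoinGenerator

/-! ### Koszul homology and the long exact sequence of the cone -/

section Homology

variable {R : Type*} [CommRing R] {M N : Type*} [AddCommGroup M] [Module R M]
  [AddCommGroup N] [Module R N]

/-- The cycles of degree `i` in the Koszul complex of a linear form. -/
noncomputable def cycles (f : Module.Dual R M) (i : ℕ) : Submodule R (ExteriorAlgebra R M) :=
  LinearMap.ker (contraction f) ⊓ ⋀[R]^i M

/-- The boundaries of degree `i` in the Koszul complex of a linear form. -/
noncomputable def boundaries (f : Module.Dual R M) (i : ℕ) : Submodule R (ExteriorAlgebra R M) :=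
  (⋀[R]^(i + 1) M).map (contraction f)

/-- The homology in degree `i` of the Koszul complex of a linear form. -/
abbrev Homology (f : Module.Dual R M) (i : ℕ) : Type _ :=
  cycles f i ⧸ (boundaries f i).submoduleOf (cycles f i)

theorem mem_cycles {f : Module.Dual R M} {i : ℕ} {x : ExteriorAlgebra R M} :
    x ∈ cycles f i ↔ contraction f x = 0 ∧ x ∈ ⋀[R]^i M := Iff.rfl

/-- The homology class of a cycle. -/
noncomputable def Homology.mk (f : Module.Dual R M) (i : ℕ) : cycles f i →ₗ[R] Homology f i :=
  Submodule.mkQ _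

theorem Homology.mk_surjective (f : Module.Dual R M) (i : ℕ) :
    Function.Surjective (Homology.mk f i) :=
  Submodule.mkQ_surjective _

theorem Homology.mk_eq_zero {f : Module.Dual R M} {i : ℕ} {x : cycles f i} :
    Homology.mk f i x = 0 ↔ x.1 ∈ boundaries f i :=
  Submodule.Quotient.mk_eq_zero _

/-- The map on homology induced by a linear map that preserves cycles and boundaries. -/
noncomputable def Homology.map {f : Module.Dual R M} {g : Module.Dual R N} {i j : ℕ}
    (φ : ExteriorAlgebra R M →ₗ[R] ExteriorAlgebra R N)
    (h : ∀ x ∈ cycles f i, φ x ∈ cycles g j) (h' : ∀ x ∈ boundaries f i, φ x ∈ boundaries g j) :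
    Homology f i →ₗ[R] Homology g j :=
  Submodule.mapQ _ _ (φ.restrict h) fun x hx => h' x.1 hx

instance Homology.finite [IsNoetherianRing R] [Module.Finite R M] (f : Module.Dual R M) (i : ℕ) :
    Module.Finite R (Homology f i) := by
  have h : (cycles f i).FG := by
    have : IsNoetherian R (⋀[R]^i M) := inferInstance
    exact isNoetherian_submodule.1 this _ inf_le_right
  have := Module.Finite.iff_fg.2 h
  infer_instance

/-- Functoriality of Koszul homology. -/
noncomputable def Homology.mapOfComp {f : Module.Dual R M} {g : Module.Dual R N}
    (φ : M →ₗ[R] N) (h : g ∘ₗ φ = f) (i : ℕ) : Homology f i →ₗ[R] Homology g i :=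
  Homology.map (ExteriorAlgebra.map φ).toLinearMap
    (fun x hx => mem_cycles.2 ⟨by
      change contraction g (ExteriorAlgebra.map φ x) = 0
      rw [contraction_map, h, (mem_cycles.1 hx).1, map_zero], map_mem φ hx.2⟩)
    (by
      rintro _ ⟨y, hy, rfl⟩
      exact ⟨ExteriorAlgebra.map φ y, map_mem φ hy, by rw [contraction_map, h]; rfl⟩)

theorem Homology.mapOfComp_mapOfComp {f : Module.Dual R M} {g : Module.Dual R N}
    {φ : M →ₗ[R] N} (h : g ∘ₗ φ = f) {ψ : N →ₗ[R] M} (h' : f ∘ₗ ψ = g)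
    (hφψ : ψ ∘ₗ φ = LinearMap.id) (i : ℕ) (x : Homology f i) :
    Homology.mapOfComp ψ h' i (Homology.mapOfComp φ h i x) = x := by
  obtain ⟨x, rfl⟩ := Homology.mk_surjective f i x
  refine congrArg (Homology.mk f i) (Subtype.ext ?_)
  have h2 : (ExteriorAlgebra.map ψ).comp (ExteriorAlgebra.map φ) = AlgHom.id R _ := by
    rw [ExteriorAlgebra.map_comp_map, hφψ, ExteriorAlgebra.map_id]
  exact congr($h2 x.1)

/-- An isomorphism of modules with linear forms induces an isomorphism on Koszul homology. -/
noncomputable def Homology.equiv {f : Module.Dual R M} {g : Module.Dual R N}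
    (e : M ≃ₗ[R] N) (h : ∀ m, g (e m) = f m) (i : ℕ) : Homology f i ≃ₗ[R] Homology g i :=
  have h1 : g ∘ₗ e.toLinearMap = f := LinearMap.ext h
  have h2 : f ∘ₗ e.symm.toLinearMap = g := LinearMap.ext fun n => by
    rw [LinearMap.comp_apply, LinearEquiv.coe_coe, ← h, e.apply_symm_apply]
  LinearEquiv.ofLinearMap (Homology.mapOfComp e.toLinearMap h1 i)
    (Homology.mapOfComp e.symm.toLinearMap h2 i)
    (LinearMap.ext fun x => Homology.mapOfComp_mapOfComp h2 h1 (by ext; simp) i x)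
    (LinearMap.ext fun x => Homology.mapOfComp_mapOfComp h1 h2 (by ext; simp) i x)

/-! The long exact sequence for the adjunction of one generator. -/

variable (g : Module.Dual R M) (c : R) (i : ℕ)

/-- The map `H_i(g) → H_i(g, c)`. -/
noncomputable def Homology.incl : Homology g i →ₗ[R] Homology (adjoin g c) i :=
  Homology.mapOfComp (LinearMap.inl R M R) (adjoin_comp_inl g c) i

/-- The map `H_{i+1}(g, c) → H_i(g)`. -/
noncomputable def Homology.proj : Homology (adjoin g c) (i + 1) →ₗ[R] Homology g i :=
  Homology.map part₁
    (fun x hx => mem_cycles.2 ⟨by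
      rw [← neg_eq_zero, ← part₁_contraction g c, (mem_cycles.1 hx).1, map_zero], part₁_mem hx.2⟩)
    (by
      rintro _ ⟨y, hy, rfl⟩
      exact ⟨- part₁ y, neg_mem (part₁_mem hy), by rw [part₁_contraction, map_neg]⟩)

variable {g c i}

/-- In cone coordinates, `(u, 0)` is the boundary of `(a, b)` exactly when `b` is a cycle and `u = d
a + c b`, so the kernel of `incl` is `c H_i(g)`. -/
theorem Homology.incl_eq_zero_iff (x : Homology g i) :
    Homology.incl g c i x = 0 ↔ ∃ y, c • y = x := by
  obtain ⟨⟨u, hu⟩, rfl⟩ := Homology.mk_surjective g i x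
  have hju : ExteriorAlgebra.map (LinearMap.inl R M R) u = join u 0 := by simp [join]
  constructor
  · intro h
    obtain ⟨z, hz, hzu⟩ := Homology.mk_eq_zero.1 h
    change contraction (adjoin g c) z = ExteriorAlgebra.map (LinearMap.inl R M R) u at hzu
    have h0 := part₀_contraction g c z
    have h1 := part₁_contraction g c z
    rw [hzu, hju, part₀_join] at h0
    rw [hzu, hju, part₁_join] at h1
    refine ⟨Homology.mk g i ⟨part₁ z, neg_eq_zero.1 h1.symm, part₁_mem hz⟩, ?_⟩
    rw [← map_smul, ← sub_eq_zero, ← map_sub, Homology.mk_eq_zero]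
    refine ⟨- part₀ z, neg_mem (part₀_mem hz), ?_⟩
    change _ = c • part₁ z - u
    rw [h0, map_neg]
    abel
  · rintro ⟨y, hy⟩
    rw [← hy]
    obtain ⟨⟨v, hv⟩, rfl⟩ := Homology.mk_surjective g i y
    rw [← map_smul]
    refine Homology.mk_eq_zero.2 ⟨join 0 v, join_mem (zero_mem _) hv.2, ?_⟩
    change _ = ExteriorAlgebra.map (LinearMap.inl R M R) (c • v)
    rw [contraction_adjoin_join, (mem_cycles.1 hv).1]
    simp [join]

/-- An element of degree zero has no component in `e ∧ ⋀ M`. -/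
theorem Homology.incl_surjective_zero : Function.Surjective (Homology.incl g c 0) := by
  intro x
  obtain ⟨⟨w, hw⟩, rfl⟩ := Homology.mk_surjective _ _ x
  refine ⟨Homology.mk g 0 ⟨part₀ w, contraction_eq_zero _ (part₀_mem hw.2), part₀_mem hw.2⟩,
    congrArg (Homology.mk _ _) (Subtype.ext ?_)⟩
  have h := join_part w
  rw [part₁_eq_zero hw.2] at h
  simpa [join] using! h

theorem Homology.exact_incl_proj :
    Function.Exact (Homology.incl g c (i + 1)) (Homology.proj g c i) := by
  intro x
  constructor
  · intro h
    obtain ⟨⟨w, hw⟩, rfl⟩ := Homology.mk_surjective _ _ x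
    obtain ⟨z, hz, hzw⟩ := Homology.mk_eq_zero.1 h
    change contraction g z = part₁ w at hzw
    have hw0 := part₀_contraction g c w
    rw [(mem_cycles.1 hw).1, map_zero] at hw0
    -- The second component of `w` is `d z`; adding the boundary of `join 0 z`, which is `(c z, -d
    -- z)`, moves the cycle into the image of `⋀ M`.
    refine ⟨Homology.mk g (i + 1) ⟨part₀ w + c • z, mem_cycles.2 ⟨?_, add_mem (part₀_mem hw.2)
      (Submodule.smul_mem _ _ hz)⟩⟩, ?_⟩
    · rw [map_add, map_smul, hzw, ← hw0]
    · rw [← sub_eq_zero]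
      refine Homology.mk_eq_zero.2 ⟨join 0 z, join_mem (zero_mem _) hz, ?_⟩
      change _ = ExteriorAlgebra.map (LinearMap.inl R M R) (part₀ w + c • z) - w
      rw [contraction_adjoin_join, hzw]
      nth_rewrite 3 [← join_part w]
      simp only [join, map_zero, map_add, map_neg, mul_neg]
      abel
  · rintro ⟨y, rfl⟩
    obtain ⟨⟨u, hu⟩, rfl⟩ := Homology.mk_surjective _ _ y
    refine Homology.mk_eq_zero.2 ⟨0, zero_mem _, ?_⟩
    have h := part₁_join u 0
    simp only [join, map_zero, mul_zero, add_zero] at h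
    exact (map_zero _).trans h.symm

/-- A pair `(u, v)` is a cycle exactly when `d v = 0` and `d u + c v = 0`. Hence a cycle `v` lifts
if and only if `c v` is a boundary `d z`, and then `(-z, v)` is a lift. -/
theorem Homology.proj_range (x : Homology g i) :
    (∃ y, Homology.proj g c i y = x) ↔ c • x = 0 := by
  constructor
  · rintro ⟨y, rfl⟩
    obtain ⟨⟨w, hw⟩, rfl⟩ := Homology.mk_surjective _ _ y
    have hw0 := part₀_contraction g c w
    rw [(mem_cycles.1 hw).1, map_zero] at hw0
    refine Homology.mk_eq_zero.2 ⟨- part₀ w, neg_mem (part₀_mem hw.2), ?_⟩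
    rw [map_neg, neg_eq_iff_add_eq_zero]
    exact hw0.symm
  · intro h
    obtain ⟨⟨v, hv⟩, rfl⟩ := Homology.mk_surjective _ _ x
    rw [← map_smul] at h
    obtain ⟨z, hz, hzv⟩ := Homology.mk_eq_zero.1 h
    change contraction g z = c • v at hzv
    refine ⟨Homology.mk _ _ ⟨join (-z) v, mem_cycles.2 ⟨?_, join_mem (neg_mem hz) hv.2⟩⟩,
      congrArg (Homology.mk _ _) (Subtype.ext (part₁_join _ _))⟩
    rw [contraction_adjoin_join, (mem_cycles.1 hv).1, map_neg, hzv]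
    simp [join]

end Homology

end Koszul

/-! ### Sliding depth under the adjunction of a generator -/

namespace Koszul

universe w

section Sliding

variable {R : Type w} [CommRing R] [IsLocalRing R] {M N : Type w} [AddCommGroup M] [Module R M]
  [AddCommGroup N] [Module R N]

/-- The Koszul homology of `f` in degree `i` has depth at least `n - q + i` for all `i`. -/
def Sliding (n q : ℕ) (f : Module.Dual R M) : Prop :=
  ∀ i, DepthGE R (Homology f i) (n + i - q)

theorem Sliding.equiv {n q : ℕ} {f : Module.Dual R M} {g : Module.Dual R N} (h : Sliding n q f)
    (e : M ≃ₗ[R] N) (he : ∀ m, g (e m) = f m) : Sliding n q g :=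
  fun i => (h i).of_linearEquiv (Homology.equiv e he i)

variable (g : Module.Dual R M) (c : R)

/-- The submodule `c H_i(g)` of `H_i(g)`. -/
noncomputable abbrev imageSMul (i : ℕ) : Submodule R (Homology g i) :=
  LinearMap.range (LinearMap.lsmul R (Homology g i) c)

/-- The submodule of `H_i(g)` annihilated by `c`. -/
noncomputable abbrev kerSMul (i : ℕ) : Submodule R (Homology g i) :=
  LinearMap.ker (LinearMap.lsmul R (Homology g i) c)

/-- The map `H_i(g) / c H_i(g) → H_i(g, c)`. -/
noncomputable def quotIncl (i : ℕ) : (Homology g i ⧸ imageSMul g c i) →ₗ[R]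
    Homology (adjoin g c) i :=
  Submodule.liftQ _ (Homology.incl g c i) (by
    rintro _ ⟨y, rfl⟩
    exact (Homology.incl_eq_zero_iff _).2 ⟨y, rfl⟩)

omit [IsLocalRing R] in
theorem quotIncl_injective (i : ℕ) : Function.Injective (quotIncl g c i) := by
  rw [← LinearMap.ker_eq_bot]
  refine Submodule.ker_liftQ_eq_bot _ _ _ fun x hx => ?_
  obtain ⟨y, hy⟩ := (Homology.incl_eq_zero_iff _).1 hx
  exact ⟨y, hy⟩

omit [IsLocalRing R] in
theorem quotIncl_zero_surjective : Function.Surjective (quotIncl g c 0) := fun x => by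
  obtain ⟨y, hy⟩ := Homology.incl_surjective_zero x
  exact ⟨Submodule.Quotient.mk y, hy⟩

/-- The map from `H_{i+1}(g, c)` onto the part of `H_i(g)` annihilated by `c`. -/
noncomputable def projKer (i : ℕ) : Homology (adjoin g c) (i + 1) →ₗ[R] kerSMul g c i :=
  (Homology.proj g c i).codRestrict _ fun y => (Homology.proj_range _).1 ⟨y, rfl⟩

omit [IsLocalRing R] in
theorem projKer_surjective (i : ℕ) : Function.Surjective (projKer g c i) := fun x => by
  obtain ⟨y, hy⟩ := (Homology.proj_range x.1).2 x.2
  exact ⟨y, Subtype.ext hy⟩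

omit [IsLocalRing R] in
theorem exact_quotIncl_projKer (i : ℕ) :
    Function.Exact (quotIncl g c (i + 1)) (projKer g c i) := by
  intro x
  rw [← Subtype.coe_inj]
  refine (Homology.exact_incl_proj x).trans ⟨?_, ?_⟩
  · rintro ⟨y, hy⟩
    exact ⟨Submodule.Quotient.mk y, hy⟩
  · rintro ⟨y, hy⟩
    obtain ⟨y, rfl⟩ := Submodule.Quotient.mk_surjective _ y
    exact ⟨y, hy⟩

variable {g c}

omit [IsLocalRing R] in
theorem exact_subtype_mkQ {A : Type*} [AddCommGroup A] [Module R A] (S : Submodule R A) :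
    Function.Exact S.subtype S.mkQ := fun x => by simp

omit [IsLocalRing R] in
theorem exact_ker_subtype_rangeRestrict {A B : Type*} [AddCommGroup A] [Module R A]
    [AddCommGroup B] [Module R B] (φ : A →ₗ[R] B) :
    Function.Exact (LinearMap.ker φ).subtype φ.rangeRestrict := fun x => by
  rw [← Subtype.coe_inj]
  simp

/-- The kernel in degree `i` contributes to homology in degree `i + 1`, where the required bound is
`n + (i + 1) - (q + 1) = n + i - q`. In degree zero only the quotient is present. -/
theorem Sliding.adjoin_of_quotient_of_ker {n q : ℕ}
    (hQ : ∀ i, DepthGE R (Homology g i ⧸ imageSMul g c i) (n + i - (q + 1)))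
    (hK : ∀ i, DepthGE R (kerSMul g c i) (n + i - q)) : Sliding n (q + 1) (adjoin g c) := by
  intro i
  cases i with
  | zero =>
    exact (hQ 0).of_linearEquiv (LinearEquiv.ofBijective (quotIncl g c 0)
      ⟨quotIncl_injective g c 0, quotIncl_zero_surjective g c⟩)
  | succ i =>
    exact DepthGE.middle (quotIncl_injective g c (i + 1)) (exact_quotIncl_projKer g c i)
      (projKer_surjective g c i) (hQ (i + 1)) ((hK i).mono (by omega))

/-- Adjoining a generator that is regular on the Koszul homology. -/
theorem Sliding.adjoin_of_regular {n q : ℕ} (h : Sliding n q g)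
    (hc : ∀ i (z : Homology g i), c • z = 0 → z = 0) : Sliding n (q + 1) (adjoin g c) := by
  have hbot : ∀ i, kerSMul g c i = ⊥ := fun i => LinearMap.ker_eq_bot'.2 (hc i)
  refine Sliding.adjoin_of_quotient_of_ker (fun i => ?_) fun i => ?_
  -- The cokernel of an injective endomorphism loses at most one in depth, matching the step from
  -- `q` to `q + 1`.
  · refine DepthGE.right (LinearMap.ker_eq_bot.1 (hbot i))
      (LinearMap.exact_map_mkQ_range (LinearMap.lsmul R (Homology g i) c))
      (Submodule.mkQ_surjective _) (h i) ((h i).mono ?_) ?_ <;> omega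
  · rw [hbot]
    exact DepthGE.of_subsingleton _

/-- For `c = 0` both the quotient and the kernel are all of `H_i(g)`, so `H_{i+1}(g, 0)` is an
extension of `H_i(g)` by `H_{i+1}(g)`. -/
theorem Sliding.adjoin_zero {n q : ℕ} (h : Sliding n q g) : Sliding n (q + 1) (adjoin g 0) := by
  have hker : ∀ i, kerSMul g 0 i = ⊤ := fun i => by
    rw [kerSMul, map_zero, LinearMap.ker_zero]
  have him : ∀ i, imageSMul g 0 i = ⊥ := fun i => by
    rw [imageSMul, map_zero, LinearMap.range_zero]
  refine Sliding.adjoin_of_quotient_of_ker (fun i => ?_) fun i => ?_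
  · exact ((h i).mono (by omega)).of_linearEquiv (Submodule.quotEquivOfEqBot _ (him i)).symm
  · exact (h i).of_linearEquiv ((LinearEquiv.ofTop _ (hker i)).symm)

/-- The generators `m * y, m` generate the same Koszul complex as `m, 0`. -/
theorem Sliding.adjoin_mul_adjoin {n q : ℕ} {m y : R} (h : Sliding n q (adjoin g m)) :
    Sliding n (q + 1) (adjoin (adjoin g (m * y)) m) := by
  -- The change of basis realizing `m y - y * m = 0`: the basis vector over the generator `0` goes
  -- to the one over `m y` minus `y` times the one over `m`.
  let e : ((M × R) × R) ≃ₗ[R] ((M × R) × R) :=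
    { toFun := fun p => ((p.1.1, p.2), p.1.2 - y * p.2)
      invFun := fun p => ((p.1.1, p.2 + y * p.1.2), p.1.2)
      map_add' := fun p p' => by
        ext <;> simp
        ring
      map_smul' := fun r p => by
        ext <;> simp
        ring
      left_inv := fun p => by
        ext <;> simp
      right_inv := fun p => by
        ext <;> simp }
  refine h.adjoin_zero.equiv e fun p => ?_
  change adjoin (adjoin g (m * y)) m ((p.1.1, p.2), p.1.2 - y * p.2) = _
  simp only [adjoin_apply]
  ring

/-- Depth along `0 → m H → H → H / m H → 0`, where the quotient is allowed one less. -/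
theorem DepthGE.image_smul {n q i : ℕ} {m : R} (h : DepthGE R (Homology g i) (n + i - q))
    (hQ : DepthGE R (Homology g i ⧸ imageSMul g m i) (n + i - (q + 1))) :
    DepthGE R (imageSMul g m i) (n + i - q) :=
  DepthGE.left (Submodule.injective_subtype _) (exact_subtype_mkQ _) (Submodule.mkQ_surjective _)
    h hQ (by omega)

/-- Depth along `0 → ker m → H → m H → 0`. -/
theorem DepthGE.ker_smul {n q i : ℕ} {m : R} (h : DepthGE R (Homology g i) (n + i - q))
    (hQ : DepthGE R (Homology g i ⧸ imageSMul g m i) (n + i - (q + 1))) :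
    DepthGE R (kerSMul g m i) (n + i - q) :=
  DepthGE.left (Submodule.injective_subtype _) (exact_ker_subtype_rangeRestrict _)
    (LinearMap.surjective_rangeRestrict _) h (DepthGE.image_smul h hQ) (by omega)

/-- The short exact sequence for adjoining `m` is used backwards: its middle term is known from
`adjoin_mul_adjoin`. The bound in degree `i` controls the kernel of `m` on `H_i`, which is the
right-hand term next to the quotient in degree `i + 1`. -/
theorem Sliding.quotient_of_mul {n q : ℕ} {m y : R} (h : Sliding n q (adjoin g (m * y)))
    (h' : Sliding n q (adjoin g m)) (i : ℕ) :
    DepthGE R (Homology (adjoin g (m * y)) i ⧸ imageSMul (adjoin g (m * y)) m i)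
      (n + i - (q + 1)) := by
  have hD := h'.adjoin_mul_adjoin (y := y)
  induction i with
  | zero =>
    exact (hD 0).of_linearEquiv (LinearEquiv.ofBijective (quotIncl (adjoin g (m * y)) m 0)
      ⟨quotIncl_injective _ m 0, quotIncl_zero_surjective _ m⟩).symm
  | succ i ih =>
    exact DepthGE.left (quotIncl_injective _ m (i + 1)) (exact_quotIncl_projKer _ m i)
      (projKer_surjective _ m i) (hD (i + 1)) (DepthGE.ker_smul (h i) ih) (by omega)

/-- Adjoining `m * x` to generators one of which is `m * y`, when `x` is regular on the
Koszul homology and `m * y` may be replaced by `m`. -/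
theorem Sliding.adjoin_mul {n q : ℕ} {m x y : R} (h : Sliding n q (adjoin g (m * y)))
    (h' : Sliding n q (adjoin g m))
    (hx : ∀ i (z : Homology (adjoin g (m * y)) i), x • z = 0 → z = 0) :
    Sliding n (q + 1) (adjoin (adjoin g (m * y)) (m * x)) := by
  have hC := h.quotient_of_mul h'
  have hker : ∀ i, kerSMul (adjoin g (m * y)) m i = kerSMul (adjoin g (m * y)) (m * x) i := by
    intro i
    ext z
    simp only [LinearMap.mem_ker, LinearMap.lsmul_apply]
    constructor
    · intro hz
      rw [mul_comm m x, mul_smul, hz, smul_zero]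
    · intro hz
      rw [mul_comm m x, mul_smul] at hz
      exact hx i _ hz
  refine Sliding.adjoin_of_quotient_of_ker (fun i => ?_) fun i => ?_
  -- With equal kernels, `m x H ≅ H / ker (m x) = H / ker m ≅ m H`.
  · have him : DepthGE R (imageSMul (adjoin g (m * y)) (m * x) i) (n + i - q) :=
      (DepthGE.image_smul (h i) (hC i)).of_linearEquiv
        ((LinearMap.quotKerEquivRange _).symm.trans
          ((Submodule.quotEquivOfEq _ _ (hker i)).trans (LinearMap.quotKerEquivRange _)))
    refine DepthGE.right (Submodule.injective_subtype _) (exact_subtype_mkQ _)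
      (Submodule.mkQ_surjective _) him ((h i).mono ?_) ?_ <;> omega
  · rw [← hker i]
    exact DepthGE.ker_smul (h i) (hC i)

end Sliding

end Koszul

/-! ### Elements that are regular on Koszul homology -/

namespace Koszul

section Join

variable {R : Type*} [CommRing R] {M : Type*} [AddCommGroup M] [Module R M]

theorem join_add (u v u' v' : ExteriorAlgebra R M) :
    join (u + u') (v + v') = join u v + join u' v' := by
  simp only [join, map_add, mul_add]
  abel

theorem join_sub (u v u' v' : ExteriorAlgebra R M) :
    join (u - u') (v - v') = join u v - join u' v' := by
  simp only [join, map_sub, mul_sub]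
  abel

theorem join_smul (r : R) (u v : ExteriorAlgebra R M) :
    join (r • u) (r • v) = r • join u v := by
  simp only [join, map_smul, mul_smul_comm, smul_add]

end Join

section Specialization

variable {R : Type*} [CommRing R] {M N : Type*} [AddCommGroup M] [Module R M]
  [AddCommGroup N] [Module R N]

/-- A ring endomorphism `σ` that is the identity modulo `x` lifts to a semilinear endomorphism of
the Koszul complex of `f` that is the identity modulo `x`, and `x` is regular on that complex. -/
def HasSpecialization (σ : R →+* R) (x : R) (f : Module.Dual R M) : Prop :=
  ∃ τ : ExteriorAlgebra R M →ₛₗ[σ] ExteriorAlgebra R M,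
    (∀ u, contraction f (τ u) = τ (contraction f u)) ∧
    (∀ i, ∀ u ∈ ⋀[R]^i M, ∃ w ∈ ⋀[R]^i M, u - τ u = x • w) ∧
    ∀ u : ExteriorAlgebra R M, x • u = 0 → u = 0

variable {σ : R →+* R} {x : R}

/-- If `x u = d z`, then `d (τ z) = τ (x u) = σ(x) τ(u) = 0`. Writing `z - τ z = x w` gives `x u = x
d w`, and cancelling `x` shows that `u` is a boundary. -/
theorem HasSpecialization.regular {f : Module.Dual R M} (h : HasSpecialization σ x f)
    (hσ : σ x = 0) (i : ℕ) (z : Homology f i) (hz : x • z = 0) : z = 0 := by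
  obtain ⟨τ, h1, h2, h3⟩ := h
  obtain ⟨⟨u, hu⟩, rfl⟩ := Homology.mk_surjective _ _ z
  rw [← map_smul] at hz
  obtain ⟨z, hz, hzu⟩ := Homology.mk_eq_zero.1 hz
  change contraction f z = x • u at hzu
  obtain ⟨w, hw, hzw⟩ := h2 _ z hz
  refine Homology.mk_eq_zero.2 ⟨w, hw, ?_⟩
  rw [← sub_eq_zero]
  refine h3 _ ?_
  rw [smul_sub, ← map_smul, ← hzw, map_sub, h1, hzu, τ.map_smulₛₗ, hσ, zero_smul, sub_zero, sub_self]

theorem HasSpecialization.equiv {f : Module.Dual R M} {g : Module.Dual R N}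
    (h : HasSpecialization σ x f) (e : M ≃ₗ[R] N) (he : ∀ m, g (e m) = f m) :
    HasSpecialization σ x g := by
  obtain ⟨τ, h1, h2, h3⟩ := h
  have hl : ∀ u, ExteriorAlgebra.map e.toLinearMap (ExteriorAlgebra.map e.symm.toLinearMap u) =
      u := fun u => by
    have h : (ExteriorAlgebra.map e.toLinearMap).comp (ExteriorAlgebra.map e.symm.toLinearMap) =
        AlgHom.id R _ := by
      rw [ExteriorAlgebra.map_comp_map, LinearEquiv.comp_symm, ExteriorAlgebra.map_id]
    exact congr($h u)
  have hf : g ∘ₗ e.toLinearMap = f := LinearMap.ext he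
  have hg : f ∘ₗ e.symm.toLinearMap = g := LinearMap.ext fun n => by
    rw [LinearMap.comp_apply, LinearEquiv.coe_coe, ← he, e.apply_symm_apply]
  refine ⟨(ExteriorAlgebra.map e.toLinearMap).toLinearMap.comp
    (τ.comp (ExteriorAlgebra.map e.symm.toLinearMap).toLinearMap), fun u => ?_, fun i u hu => ?_,
    fun u hu => ?_⟩
  · simp only [LinearMap.comp_apply, AlgHom.toLinearMap_apply]
    rw [contraction_map, hf, h1, contraction_map, hg]
  · obtain ⟨w, hw, huw⟩ := h2 i _ (map_mem e.symm.toLinearMap hu)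
    refine ⟨_, map_mem e.toLinearMap hw, ?_⟩
    rw [← map_smul, ← huw, map_sub, hl]
    rfl
  · rw [← hl u, h3 (ExteriorAlgebra.map e.symm.toLinearMap u) (by rw [← map_smul, hu, map_zero]),
      map_zero]

/-- Let `τ` act on each of the two cone coordinates. It commutes with the term `c v` of the
differential because `σ` fixes `c`. -/
theorem HasSpecialization.adjoin {g : Module.Dual R M} (h : HasSpecialization σ x g) {c : R}
    (hc : σ c = c) : HasSpecialization σ x (adjoin g c) := by
  obtain ⟨τ, h1, h2, h3⟩ := h
  let τ' : ExteriorAlgebra R (M × R) →ₛₗ[σ] ExteriorAlgebra R (M × R) :=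
    { toFun := fun w => join (τ (part₀ w)) (τ (part₁ w))
      map_add' := fun w w' => by simp only [map_add, join_add]
      map_smul' := fun r w => by simp only [map_smul, τ.map_smulₛₗ, join_smul] }
  refine ⟨τ', fun w => ?_, fun i w hw => ?_, fun w hw => ?_⟩
  · change contraction _ (join (τ (part₀ w)) (τ (part₁ w))) =
      join (τ (part₀ (contraction _ w))) (τ (part₁ (contraction _ w)))
    rw [contraction_adjoin_join, part₀_contraction, part₁_contraction, map_add, map_neg, h1, h1,
      τ.map_smulₛₗ, hc]
  · obtain ⟨a, ha, hwa⟩ := h2 i _ (part₀_mem hw)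
    cases i with
    | zero =>
      refine ⟨join a 0, join_zero_mem ha, ?_⟩
      rw [← join_smul, ← hwa, smul_zero]
      nth_rewrite 1 [← join_part w]
      change join _ _ - join _ _ = _
      rw [← join_sub, part₁_eq_zero hw, map_zero, sub_zero]
    | succ i =>
      obtain ⟨b, hb, hwb⟩ := h2 i _ (part₁_mem hw)
      refine ⟨join a b, join_mem ha hb, ?_⟩
      rw [← join_smul, ← hwa, ← hwb]
      nth_rewrite 1 [← join_part w]
      change join _ _ - join _ _ = _
      rw [← join_sub]
  · rw [← join_part w, h3 (part₀ w) (by rw [← map_smul, hw, map_zero]),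
      h3 (part₁ w) (by rw [← map_smul, hw, map_zero])]
    simp [join]

theorem exists_algebraMap_eq [Subsingleton M] (u : ExteriorAlgebra R M) :
    ∃ r, algebraMap R (ExteriorAlgebra R M) r = u := by
  induction u using left_induction with
  | algebraMap r => exact ⟨r, rfl⟩
  | add u v hu hv =>
    obtain ⟨r, rfl⟩ := hu
    obtain ⟨s, rfl⟩ := hv
    exact ⟨r + s, map_add _ _ _⟩
  | ι_mul u m _ => exact ⟨0, by rw [Subsingleton.elim m 0, map_zero, map_zero, zero_mul]⟩

theorem exteriorPower_succ_eq_bot [Subsingleton M] (i : ℕ) : ⋀[R]^(i + 1) M = ⊥ := by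
  have h : LinearMap.range (ExteriorAlgebra.ι R : M →ₗ[R] _) = ⊥ := by
    rw [eq_bot_iff]
    rintro _ ⟨m, rfl⟩
    rw [Subsingleton.elim m 0, map_zero]
    exact zero_mem _
  rw [ExteriorAlgebra.exteriorPower, h, pow_succ, Submodule.mul_bot]

/-- Base case without generators: the exterior algebra is `R`, and `τ` is `σ` itself. -/
theorem HasSpecialization.of_subsingleton [Subsingleton M] (f : Module.Dual R M)
    (hσ : ∀ r, ∃ s, r - σ r = x * s) (hx : ∀ r, x * r = 0 → r = 0) :
    HasSpecialization σ x f := by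
  let τ : ExteriorAlgebra R M →ₛₗ[σ] ExteriorAlgebra R M :=
    { toFun := fun u => algebraMap R _ (σ (ExteriorAlgebra.algebraMapInv u))
      map_add' := fun u v => by simp only [map_add]
      map_smul' := fun r u => by simp [Algebra.smul_def] }
  have hτ : ∀ r, τ (algebraMap R _ r) = algebraMap R _ (σ r) := fun r => by
    change algebraMap R _ (σ (ExteriorAlgebra.algebraMapInv (algebraMap R _ r))) = _
    rw [ExteriorAlgebra.algebraMap_leftInverse]
  refine ⟨τ, fun u => ?_, fun i u hu => ?_, fun u hu => ?_⟩
  · obtain ⟨r, rfl⟩ := exists_algebraMap_eq u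
    rw [hτ, contraction_algebraMap, contraction_algebraMap, map_zero]
  · cases i with
    | zero =>
      obtain ⟨r, rfl⟩ := exists_algebraMap_eq u
      obtain ⟨s, hs⟩ := hσ r
      refine ⟨algebraMap R _ s, ?_, ?_⟩
      · rw [ExteriorAlgebra.exteriorPower, pow_zero]
        exact Submodule.mem_one.2 ⟨s, rfl⟩
      · rw [hτ, ← map_sub, hs, map_mul, Algebra.smul_def]
    | succ i =>
      rw [exteriorPower_succ_eq_bot, Submodule.mem_bot] at hu
      exact ⟨0, zero_mem _, by rw [hu, map_zero, smul_zero, sub_zero]⟩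
  · obtain ⟨r, rfl⟩ := exists_algebraMap_eq u
    rw [Algebra.smul_def, ← map_mul, ExteriorAlgebra.algebraMap_eq_zero_iff] at hu
    rw [hx r hu, map_zero]

end Specialization

section Family

variable {R : Type*} [CommRing R]

/-- The free module on `Option ι` is the product of the free module on `ι` and the ring. -/
noncomputable def finsuppOptionEquiv (R : Type*) [CommRing R] (ι : Type*) :
    ((ι →₀ R) × R) ≃ₗ[R] (Option ι →₀ R) :=
  LinearEquiv.ofLinearMap
    (LinearMap.coprod (Finsupp.lmapDomain R R some) (Finsupp.lsingle none))
    (Finsupp.linearCombination R fun o : Option ι =>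
      o.elim ((0, 1) : (ι →₀ R) × R) fun i => (Finsupp.single i 1, 0))
    (by
      refine Finsupp.lhom_ext' fun o => LinearMap.ext_ring ?_
      cases o <;> simp)
    (by
      refine LinearMap.prod_ext (Finsupp.lhom_ext' fun o => LinearMap.ext_ring ?_)
        (LinearMap.ext_ring ?_) <;> simp)

theorem linearCombination_finsuppOptionEquiv {ι : Type*} (a : Option ι → R) (p : (ι →₀ R) × R) :
    Finsupp.linearCombination R a (finsuppOptionEquiv R ι p) =
      adjoin (Finsupp.linearCombination R fun i => a (some i)) (a none) p := by
  have h : Finsupp.linearCombination R a ∘ₗ (finsuppOptionEquiv R ι).toLinearMap =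
      adjoin (Finsupp.linearCombination R fun i => a (some i)) (a none) := by
    refine LinearMap.prod_ext (Finsupp.lhom_ext' fun o => LinearMap.ext_ring ?_)
        (LinearMap.ext_ring ?_) <;> simp [finsuppOptionEquiv, adjoin]
  exact congr($h p)

theorem linearCombination_domLCongr {ι κ : Type*} (e : ι ≃ κ) (a : κ → R) (p : ι →₀ R) :
    Finsupp.linearCombination R a (Finsupp.domLCongr (R := R) (M := R) e p) =
      Finsupp.linearCombination R (fun i => a (e i)) p := by
  have h : Finsupp.linearCombination R a ∘ₗ (Finsupp.domLCongr (R := R) (M := R) e).toLinearMap =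
      Finsupp.linearCombination R (fun i => a (e i)) :=
    Finsupp.lhom_ext' fun o => LinearMap.ext_ring (by simp)
  exact congr($h p)

theorem HasSpecialization.linearCombination {σ : R →+* R} {x : R}
    (hσ : ∀ r, ∃ s, r - σ r = x * s) (hx : ∀ r, x * r = 0 → r = 0) {ι : Type*} [Finite ι]
    (a : ι → R) (ha : ∀ i, σ (a i) = a i) :
    HasSpecialization σ x (Finsupp.linearCombination R a) := by
  induction ι using Finite.induction_empty_option with
  | of_equiv e ih =>
    exact (ih (fun i => a (e i)) fun i => ha _).equiv (Finsupp.domLCongr e)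
      (linearCombination_domLCongr e a)
  | h_empty => exact .of_subsingleton _ hσ hx
  | h_option ih =>
    exact ((ih (fun i => a (some i)) fun i => ha _).adjoin (ha none)).equiv
      (finsuppOptionEquiv R _) (linearCombination_finsuppOptionEquiv a)

end Family

end Koszul

/-! ### Monomials in a family of variables -/

section Variables

variable {R V : Type*} [CommRing R]

/-- A family of regular elements each of which can be set to zero by an endomorphism of the ring
that fixes the others and is the identity modulo that element. -/
structure IsVariableFamily (x : V → R) : Prop where
  regular : ∀ v r, x v * r = 0 → r = 0
  exists_kill : ∀ v, ∃ σ : R →+* R, σ (x v) = 0 ∧ (∀ w, w ≠ v → σ (x w) = x w) ∧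
    ∀ r, ∃ s, r - σ r = x v * s

/-- The product of the variables in `F`. -/
noncomputable def monomialIn (x : V → R) (F : Finset V) : R :=
  ∏ v ∈ F, x v

theorem monomialIn_inter_mul_sdiff [DecidableEq V] (x : V → R) (F G : Finset V) :
    monomialIn x (F ∩ G) * monomialIn x (F \ G) = monomialIn x F :=
  Finset.prod_inter_mul_prod_sdiff _ _ _

/-- The linear form of the Koszul complex of the monomials of a family of finite sets. -/
noncomputable abbrev monomialForm (x : V → R) {ι : Type*} (F : ι → Finset V) :
    Module.Dual R (ι →₀ R) :=
  Finsupp.linearCombination R fun i => monomialIn x (F i)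

/-- A monomial in variables that do not occur in the generators is regular on
their Koszul homology. -/
theorem IsVariableFamily.monomialIn_regular {x : V → R} (hx : IsVariableFamily x) {ι : Type*}
    [Finite ι] (F : ι → Finset V) (A : Finset V) (hA : ∀ v ∈ A, ∀ i, v ∉ F i) (i : ℕ)
    (z : Koszul.Homology (monomialForm x F) i) (hz : monomialIn x A • z = 0) : z = 0 := by
  classical
  induction A using Finset.induction_on with
  | empty => simpa [monomialIn] using hz
  | insert v A hv ih =>
    rw [monomialIn, Finset.prod_insert hv, mul_smul] at hz
    -- It remains to cancel the single variable `x v`; the endomorphism that kills it fixes all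
    -- generators.
    refine ih (fun w hw => hA w (Finset.mem_insert_of_mem hw)) ?_
    obtain ⟨σ, h1, h2, h3⟩ := hx.exists_kill v
    refine Koszul.HasSpecialization.regular
      (Koszul.HasSpecialization.linearCombination h3 (hx.regular v) _ fun j => ?_) h1 i _ hz
    rw [monomialIn, map_prod]
    refine Finset.prod_congr rfl fun w hw => h2 w ?_
    rintro rfl
    exact hA _ (Finset.mem_insert_self _ _) j hw

end Variables

/-! ### The local polynomial ring -/

section LocalPolynomialRing

open MvPolynomial

universe u v

variable (V : Type u) (k : Type v) [Field k]

/-- The variables of the local polynomial ring. -/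
noncomputable def localVar (i : V) : LocalPolynomialRing V k :=
  algebraMap (MvPolynomial V k) _ (X i)

instance : IsDomain (LocalPolynomialRing V k) :=
  IsLocalization.isDomain_localization (idealOfVars V k).primeCompl_le_nonZeroDivisors

variable {V}

theorem localVar_mem (i : V) :
    localVar V k i ∈ IsLocalRing.maximalIdeal (LocalPolynomialRing V k) := by
  rw [localVar, IsLocalization.AtPrime.to_map_mem_maximal_iff _ (idealOfVars V k),
    idealOfVars_eq_ker]
  simp [RingHom.mem_ker]

theorem localVar_ne_zero (i : V) : localVar V k i ≠ 0 := by
  rw [localVar, Ne, IsLocalization.to_map_eq_zero_iff (LocalPolynomialRing V k)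
    (idealOfVars V k).primeCompl_le_nonZeroDivisors]
  exact X_ne_zero i

open Classical in
/-- The endomorphism of the polynomial ring that sets the variables in `A` to zero. -/
noncomputable def killVars (A : Set V) : MvPolynomial V k →+* MvPolynomial V k :=
  (aeval (R := k) fun i => if i ∈ A then (0 : MvPolynomial V k) else X i).toRingHom

/-- Setting variables to zero preserves the constant term; this lets the endomorphism pass to the
localization. -/
theorem idealOfVars_eq_comap_killVars (A : Set V) :
    idealOfVars V k = (idealOfVars V k).comap (killVars k A) := by
  have h : (constantCoeff (R := k) (σ := V)).comp (killVars k A) = constantCoeff := by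
    refine MvPolynomial.ringHom_ext (fun r => by simp [killVars]) fun i => ?_
    by_cases hi : i ∈ A <;> simp [killVars, hi]
  rw [idealOfVars_eq_ker, RingHom.comap_ker, h]

/-- The endomorphism of the local polynomial ring that sets the variables in `A` to zero. -/
noncomputable def localKillVars (A : Set V) :
    LocalPolynomialRing V k →+* LocalPolynomialRing V k :=
  Localization.localRingHom _ _ (killVars k A) (idealOfVars_eq_comap_killVars k A)

variable {k} in
theorem localKillVars_localVar_of_mem {A : Set V} {i : V} (hi : i ∈ A) :
    localKillVars k A (localVar V k i) = 0 := by
  rw [localKillVars, localVar, Localization.localRingHom_to_map]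
  simp [killVars, hi]

variable {k} in
theorem localKillVars_localVar_of_notMem {A : Set V} {i : V} (hi : i ∉ A) :
    localKillVars k A (localVar V k i) = localVar V k i := by
  rw [localKillVars, localVar, Localization.localRingHom_to_map]
  simp [killVars, hi]

/-- Modulo the variables in `A`, the identity and `localKillVars` are ring homomorphisms that agree
on constants and variables. -/
theorem sub_localKillVars_mem (A : Set V) (r : LocalPolynomialRing V k) :
    r - localKillVars k A r ∈ Ideal.span (localVar V k '' A) := by
  rw [← Ideal.Quotient.eq]
  have h : Ideal.Quotient.mk (Ideal.span (localVar V k '' A)) =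
      (Ideal.Quotient.mk (Ideal.span (localVar V k '' A))).comp (localKillVars k A) := by
    refine IsLocalization.ringHom_ext (idealOfVars V k).primeCompl
      (MvPolynomial.ringHom_ext (fun r => ?_) fun i => ?_)
    · simp [localKillVars, Localization.localRingHom_to_map, killVars]
    · change Ideal.Quotient.mk _ (localVar V k i) =
        Ideal.Quotient.mk _ (localKillVars k A (localVar V k i))
      by_cases hi : i ∈ A
      · rw [localKillVars_localVar_of_mem hi, map_zero, Ideal.Quotient.eq_zero_iff_mem]
        exact Ideal.subset_span ⟨i, hi, rfl⟩
      · rw [localKillVars_localVar_of_notMem hi]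
  exact congr($h r)

/-- The ideal is the kernel of an endomorphism of a domain; hence a variable outside `A`, being
fixed and nonzero, is regular modulo the ideal. -/
theorem mem_span_localVar_iff (A : Set V) (r : LocalPolynomialRing V k) :
    r ∈ Ideal.span (localVar V k '' A) ↔ localKillVars k A r = 0 := by
  constructor
  · intro hr
    have h : Ideal.span (localVar V k '' A) ≤ RingHom.ker (localKillVars k A) := by
      rw [Ideal.span_le]
      rintro _ ⟨i, hi, rfl⟩
      exact localKillVars_localVar_of_mem hi
    exact h hr
  · intro hr
    simpa [hr] using sub_localKillVars_mem k A r

/-- Each variable outside `A` is regular on the quotient and its cokernel is the quotient by one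
more variable. The case `A = ∅` gives depth at least `n` for the ring. -/
theorem depthGE_quotient_localVar [Finite V] (t : ℕ) (A : Finset V)
    (hA : t + A.card ≤ Nat.card V) :
    DepthGE (LocalPolynomialRing V k)
      (LocalPolynomialRing V k ⧸ Ideal.span (localVar V k '' (A : Set V))) t := by
  classical
  have := Fintype.ofFinite V
  induction t generalizing A with
  | zero => exact DepthGE.zero
  | succ t ih =>
    obtain ⟨v, hv⟩ : ∃ v, v ∉ A := by
      by_contra! h
      rw [Nat.card_eq_fintype_card, ← Finset.card_univ, ← Finset.eq_univ_of_forall h] at hA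
      omega
    have hle : Ideal.span (localVar V k '' (A : Set V)) ≤
        Ideal.span (localVar V k '' (insert v A : Finset V)) :=
      Ideal.span_mono (Set.image_mono (by simp))
    refine DepthGE.succ_of_regular (localVar_mem k v)
      (f := LinearMap.lsmul _ _ (localVar V k v)) (fun _ => rfl) ?_
      (g := Submodule.factor hle) ?_ (Submodule.factor_surjective hle)
      (ih (insert v A) (by rw [Finset.card_insert_of_notMem hv]; omega))
    · rw [← LinearMap.ker_eq_bot, LinearMap.ker_eq_bot']
      intro z hz
      obtain ⟨r, rfl⟩ := Submodule.Quotient.mk_surjective _ z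
      rw [LinearMap.lsmul_apply, ← Submodule.Quotient.mk_smul, Submodule.Quotient.mk_eq_zero,
        smul_eq_mul, mem_span_localVar_iff, map_mul,
        localKillVars_localVar_of_notMem (by simpa using hv)] at hz
      rw [Submodule.Quotient.mk_eq_zero, mem_span_localVar_iff]
      exact (mul_eq_zero.1 hz).resolve_left (localVar_ne_zero k v)
    · intro z
      obtain ⟨r, rfl⟩ := Submodule.Quotient.mk_surjective _ z
      change Submodule.Quotient.mk r = 0 ↔ _
      rw [Submodule.Quotient.mk_eq_zero, Finset.coe_insert, Set.image_insert_eq,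
        Ideal.mem_span_insert]
      constructor
      · rintro ⟨a, z, hz, rfl⟩
        refine ⟨Submodule.Quotient.mk a, ?_⟩
        rw [LinearMap.lsmul_apply, ← Submodule.Quotient.mk_smul, Submodule.Quotient.eq]
        have := neg_mem hz
        convert this using 1
        rw [smul_eq_mul]
        ring
      · rintro ⟨a, ha⟩
        obtain ⟨a, rfl⟩ := Submodule.Quotient.mk_surjective _ a
        rw [LinearMap.lsmul_apply, ← Submodule.Quotient.mk_smul, eq_comm,
          Submodule.Quotient.eq] at ha
        exact ⟨a, _, ha, by rw [smul_eq_mul]; ring⟩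

theorem depthGE_localPolynomialRing [Finite V] :
    DepthGE (LocalPolynomialRing V k) (LocalPolynomialRing V k) (Nat.card V) :=
  (depthGE_quotient_localVar k (Nat.card V) ∅ (by simp)).of_linearEquiv
    (Submodule.quotEquivOfEqBot _ (by simp))

theorem isVariableFamily_localVar : IsVariableFamily (localVar V k) where
  regular v r hr := (mul_eq_zero.1 hr).resolve_left (localVar_ne_zero k v)
  exists_kill v := by
    refine ⟨localKillVars k {v}, localKillVars_localVar_of_mem rfl,
      fun w hw => localKillVars_localVar_of_notMem hw, fun r => ?_⟩
    have h := sub_localKillVars_mem k {v} r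
    rw [Set.image_singleton, Ideal.mem_span_singleton] at h
    exact h

theorem algebraMap_squarefreeMonomial (F : Finset V) :
    algebraMap _ (LocalPolynomialRing V k) (squarefreeMonomial k F) =
      monomialIn (localVar V k) F := by
  rw [squarefreeMonomial, map_prod]
  rfl

end LocalPolynomialRing

/-! ### Comparison with the Koszul complex -/

namespace Koszul

universe u w

section Comparison

variable {R : Type w} [CommRing R] {ι : Type u} (a : ι → R)

theorem koszulComplex_d (i : ℕ) :
    (koszulComplex a).d (i + 1) i =
      ModuleCat.ofHom (differential (Finsupp.linearCombination R a) i) :=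
  ChainComplex.of_d (fun i => ModuleCat.of R (⋀[R]^i (ι →₀ R)))
    (fun i => ModuleCat.ofHom (differential (Finsupp.linearCombination R a) i)) i

/-- If `j` identifies `S` with the cycles and `T` with the boundaries of the Koszul complex, then
`S / T` is its homology. -/
theorem Homology.nonempty_quotient_equiv {M N : Type*} [AddCommGroup M] [Module R M]
    [AddCommGroup N] [Module R N] (f : Module.Dual R M) (i : ℕ)
    (j : N →ₗ[R] ExteriorAlgebra R M) (hj : ∀ u ∈ ⋀[R]^i M, ∃ x, j x = u)
    (S : Submodule R N) (hS : ∀ x, x ∈ S ↔ j x ∈ cycles f i)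
    (T : Submodule R S) (hT : ∀ x : S, x ∈ T ↔ j x ∈ boundaries f i) :
    Nonempty ((S ⧸ T) ≃ₗ[R] Homology f i) := by
  let φ : S →ₗ[R] Homology f i := Homology.mk f i ∘ₗ
    (j ∘ₗ S.subtype).codRestrict (cycles f i) fun x => (hS x.1).1 x.2
  have hsurj : Function.Surjective φ := fun z => by
    obtain ⟨⟨u, hu⟩, rfl⟩ := Homology.mk_surjective _ _ z
    obtain ⟨x, rfl⟩ := hj u hu.2
    exact ⟨⟨x, (hS x).2 hu⟩, rfl⟩
  have hker : T = LinearMap.ker φ := by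
    ext x
    rw [hT, LinearMap.mem_ker]
    exact (Homology.mk_eq_zero (x := ⟨j x.1, (hS x.1).1 x.2⟩)).symm
  exact ⟨(Submodule.quotEquivOfEq _ _ hker).trans
    (LinearMap.quotKerEquivOfSurjective _ hsurj)⟩

/-- Identifies the categorical homology with cycles modulo boundaries inside the exterior algebra,
where the cone computation takes place. -/
theorem nonempty_homology_equiv (i : ℕ) :
    Nonempty ((koszulComplex a).homology i ≃ₗ[R] Homology (Finsupp.linearCombination R a) i) := by
  have hi : (ComplexShape.down ℕ).prev i = i + 1 := by simp
  let S := (koszulComplex a).sc' (i + 1) i ((ComplexShape.down ℕ).next i)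
  let e : (koszulComplex a).homology i ≅ S.moduleCatLeftHomologyData.H :=
    (koszulComplex a).homologyIsoSc' (i + 1) i _ hi rfl ≪≫ S.moduleCatHomologyIso
  let j : S.X₂ →ₗ[R] ExteriorAlgebra R (ι →₀ R) := (⋀[R]^i (ι →₀ R)).subtype
  have hg : ∀ x : S.X₂, x ∈ LinearMap.ker S.g.hom ↔
      j x ∈ cycles (Finsupp.linearCombination R a) i := by
    intro x
    have hx : j x ∈ ⋀[R]^i (ι →₀ R) := Subtype.prop (p := (· ∈ ⋀[R]^i (ι →₀ R))) x
    cases i with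
    | zero =>
      -- No differential leaves degree zero, in agreement with contraction vanishing on scalars.
      have h0 : S.g = 0 := (koszulComplex a).shape _ _ (by simp)
      rw [h0]
      exact iff_of_true rfl ⟨contraction_eq_zero _ hx, hx⟩
    | succ i =>
      have h0 : ∀ l, l = i → (((koszulComplex a).d (i + 1) l).hom x = 0 ↔
          contraction (Finsupp.linearCombination R a) (j x) = 0) := by
        rintro _ rfl
        rw [koszulComplex_d]
        exact Subtype.ext_iff
      refine (h0 _ (ChainComplex.next_nat_succ i)).trans ⟨fun h => ⟨h, hx⟩, fun h => h.1⟩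
  have hf : ∀ x : LinearMap.ker S.g.hom, x ∈ LinearMap.range S.moduleCatToCycles ↔
      j x.1 ∈ boundaries (Finsupp.linearCombination R a) i := by
    intro x
    have h0 : S.f = ModuleCat.ofHom (differential (Finsupp.linearCombination R a) i) :=
      koszulComplex_d a i
    constructor
    · rintro ⟨y, rfl⟩
      refine ⟨(show ⋀[R]^(i + 1) (ι →₀ R) from y).1, Subtype.prop _, ?_⟩
      change _ = j (S.f.hom y)
      rw [h0]
      rfl
    · rintro ⟨y, hy, hyx⟩
      refine ⟨(⟨y, hy⟩ : ⋀[R]^(i + 1) (ι →₀ R)), Subtype.ext ?_⟩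
      change S.f.hom _ = x.1
      rw [h0]
      exact Subtype.ext hyx
  obtain ⟨e'⟩ := Homology.nonempty_quotient_equiv (Finsupp.linearCombination R a) i j
    (fun u hu => ⟨(⟨u, hu⟩ : ⋀[R]^i (ι →₀ R)), rfl⟩) (LinearMap.ker S.g.hom) hg
    (LinearMap.range S.moduleCatToCycles) hf
  exact ⟨e.toLinearEquiv.trans e'⟩

end Comparison

/-- The Koszul complex of the empty family. -/
theorem Sliding.of_subsingleton {R : Type w} [CommRing R] [IsLocalRing R] {M : Type w}
    [AddCommGroup M] [Module R M] [Subsingleton M] (f : Module.Dual R M) {n : ℕ}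
    (h : DepthGE R R n) : Sliding n 0 f := by
  intro i
  cases i with
  | zero =>
    let φ : R →ₗ[R] Homology f 0 := Homology.mk f 0 ∘ₗ
      (Algebra.linearMap R (ExteriorAlgebra R M)).codRestrict (cycles f 0) fun r =>
        mem_cycles.2 ⟨contraction_algebraMap f r, by
          rw [ExteriorAlgebra.exteriorPower, pow_zero]
          exact Submodule.mem_one.2 ⟨r, rfl⟩⟩
    refine h.of_linearEquiv (LinearEquiv.ofBijective φ ⟨?_, fun z => ?_⟩)
    · rw [← LinearMap.ker_eq_bot, LinearMap.ker_eq_bot']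
      intro r hr
      obtain ⟨y, hy, hyr⟩ := Homology.mk_eq_zero.1 hr
      rw [exteriorPower_succ_eq_bot] at hy
      have hy0 : y = 0 := hy
      rw [hy0, map_zero] at hyr
      exact (ExteriorAlgebra.algebraMap_eq_zero_iff M r).1 hyr.symm
    · obtain ⟨⟨u, hu⟩, rfl⟩ := Homology.mk_surjective _ _ z
      obtain ⟨r, rfl⟩ := exists_algebraMap_eq u
      exact ⟨r, rfl⟩
  | succ i =>
    have : Subsingleton (Homology f (i + 1)) := by
      refine subsingleton_of_forall_eq 0 fun z => ?_
      obtain ⟨⟨u, hu⟩, rfl⟩ := Homology.mk_surjective _ _ z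
      have hu2 : u ∈ ⋀[R]^(i + 1) M := hu.2
      rw [exteriorPower_succ_eq_bot] at hu2
      have hu0 : u = 0 := hu2
      exact Homology.mk_eq_zero.2 (hu0 ▸ zero_mem _)
    exact DepthGE.of_subsingleton _

end Koszul

/-! ### Families of finite sets in which every nonempty subfamily has a leaf -/

section Leaves

variable {V : Type*}

/-- Every nonempty subfamily of `F` has a leaf. -/
def HasLeaves {ι : Type*} (F : ι → Finset V) : Prop :=
  ∀ S : Set ι, S.Nonempty → ∃ i ∈ S, S = {i} ∨
    ∃ j ∈ S, j ≠ i ∧ ∀ l ∈ S, l ≠ i → ∀ v ∈ F i, v ∈ F l → v ∈ F j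

theorem HasLeaves.comp {ι κ : Type*} {F : ι → Finset V} (h : HasLeaves F) (e : κ ↪ ι) :
    HasLeaves fun i => F (e i) := by
  intro S hS
  obtain ⟨_, ⟨i, hi, rfl⟩, h1 | ⟨_, ⟨j, hj, rfl⟩, hji, h1⟩⟩ := h (e '' S) (hS.image e)
  · refine ⟨i, hi, Or.inl (e.injective.image_injective ?_)⟩
    rw [h1, Set.image_singleton]
  · exact ⟨i, hi, Or.inr ⟨j, hj, fun hij => hji (congrArg e hij), fun l hl hli =>
      h1 (e l) ⟨l, hl, rfl⟩ (e.injective.ne hli)⟩⟩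

/-- The leaf condition depends only on the intersections of distinct members of the family. -/
theorem HasLeaves.of_inter {ι : Type*} {F G : ι → Finset V} (h : HasLeaves F)
    (hFG : ∀ i j, i ≠ j → ∀ v, (v ∈ F i ∧ v ∈ F j) ↔ (v ∈ G i ∧ v ∈ G j)) : HasLeaves G := by
  intro S hS
  obtain ⟨i, hi, h1 | ⟨j, hj, hji, h1⟩⟩ := h S hS
  · exact ⟨i, hi, Or.inl h1⟩
  · refine ⟨i, hi, Or.inr ⟨j, hj, hji, fun l hl hli v hvi hvl => ?_⟩⟩
    obtain ⟨h2, h3⟩ := (hFG i l hli.symm v).2 ⟨hvi, hvl⟩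
    exact ((hFG i j hji.symm v).1 ⟨h2, h1 l hl hli v h2 h3⟩).2

/-- The family obtained from `F` by removing a leaf and replacing its joint by the intersection
of the two. -/
def contractLeaf [DecidableEq V] {κ : Type*} (F : Option (Option κ) → Finset V) :
    Option κ → Finset V
  | none => F none ∩ F (some none)
  | some l => F (some (some l))

/-- Compare with the subfamily that keeps the leaf `F none` and drops the joint. Every other member
meets the leaf inside the joint, so shrinking the leaf to its intersection with the joint changes no
pairwise intersection. -/
theorem HasLeaves.contractLeaf [DecidableEq V] {κ : Type*} {F : Option (Option κ) → Finset V}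
    (h : HasLeaves F) (hF : ∀ l, l ≠ none → ∀ v ∈ F none, v ∈ F l → v ∈ F (some none)) :
    HasLeaves (contractLeaf F) := by
  refine (h.comp ⟨fun o : Option κ => o.map some, Option.map_injective (Option.some_injective _)⟩)
    |>.of_inter fun i j hij v => ?_
  rcases i with _ | i <;> rcases j with _ | j
  · exact absurd rfl hij
  · have := hF (some (some j)) (by simp) v
    simp only [Function.Embedding.coeFn_mk, Option.map_none, Option.map_some, _root_.contractLeaf,
      Finset.mem_inter]
    tauto
  · have := hF (some (some i)) (by simp) v
    simp only [Function.Embedding.coeFn_mk, Option.map_none, Option.map_some, _root_.contractLeaf,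
      Finset.mem_inter]
    tauto
  · rfl

end Leaves

/-! ### Induction over leaves for families of monomials -/

section Monomials

universe u v

open Koszul

variable {V : Type u} {R : Type (max u v)} [CommRing R] {x : V → R}

theorem sliding_monomialForm_option [IsLocalRing R] {ι : Type u} (F : Option ι → Finset V) {n q : ℕ} :
    Sliding n q (monomialForm x F) ↔
      Sliding n q (adjoin (monomialForm x fun i => F (some i)) (monomialIn x (F none))) := by
  have he := linearCombination_finsuppOptionEquiv (R := R)
    fun i => monomialIn x (F i)
  refine ⟨fun h => h.equiv (finsuppOptionEquiv _ ι).symm fun m => ?_,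
    fun h => h.equiv (finsuppOptionEquiv _ ι) he⟩
  rw [← he, LinearEquiv.apply_symm_apply]

theorem sliding_monomialForm_equiv [IsLocalRing R] {ι κ : Type u} (e : κ ≃ ι) (F : ι → Finset V) {n q : ℕ}
    (h : Sliding n q (monomialForm x fun i => F (e i))) : Sliding n q (monomialForm x F) :=
  h.equiv (Finsupp.domLCongr e) (linearCombination_domLCongr e _)

theorem IsVariableFamily.regular_adjoin (hx : IsVariableFamily x) {ι : Type u} [Finite ι] (F : Option ι → Finset V)
    (A : Finset V) (hA : ∀ v ∈ A, ∀ i, v ∉ F i) (i : ℕ)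
    (z : Homology (adjoin (monomialForm x fun i => F (some i)) (monomialIn x (F none))) i)
    (hz : monomialIn x A • z = 0) : z = 0 := by
  have he := linearCombination_finsuppOptionEquiv (R := R)
    fun i => monomialIn x (F i)
  have h := hx.monomialIn_regular F A hA i (Homology.equiv (finsuppOptionEquiv _ ι) he i z)
    (by rw [← map_smul, hz, map_zero])
  rwa [LinearEquiv.map_eq_zero_iff] at h

/-- Removing a leaf from a family and contracting its joint. -/
theorem IsVariableFamily.sliding_of_leaf [IsLocalRing R] [DecidableEq V]
    (hx : IsVariableFamily x) {κ : Type u} [Finite κ]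
    (F : Option (Option κ) → Finset V) {n q : ℕ}
    (hF : ∀ l, l ≠ none → ∀ v ∈ F none, v ∈ F l → v ∈ F (some none))
    (h : Sliding n q (monomialForm x fun i => F (some i)))
    (h' : Sliding n q (monomialForm x (contractLeaf F))) :
    Sliding n (q + 1) (monomialForm x F) := by
  -- The factorizations `m y` of the joint and `m x` of the leaf, with `m` the monomial of their
  -- intersection.
  have hy : monomialIn x (F (some none)) = monomialIn x (F none ∩ F (some none)) *
      monomialIn x (F (some none) \ F none) := by
    rw [Finset.inter_comm, monomialIn_inter_mul_sdiff]
  have hx' : monomialIn x (F none) = monomialIn x (F none ∩ F (some none)) *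
      monomialIn x (F none \ F (some none)) :=
    (monomialIn_inter_mul_sdiff _ _ _).symm
  -- A vertex of the leaf shared with any other member lies in the joint, so the variables of the
  -- leaf outside the joint occur nowhere else.
  have hreg := hx.regular_adjoin (fun i => F (some i)) (F none \ F (some none))
    fun v hv i hvi => by
      rw [Finset.mem_sdiff] at hv
      exact hv.2 (hF (some i) (by simp) v hv.1 hvi)
  rw [sliding_monomialForm_option] at h h' ⊢
  rw [hy] at h hreg
  have key := h.adjoin_mul h' hreg
  rw [← hx', ← hy] at key
  refine key.equiv ((finsuppOptionEquiv _ κ).prodCongr (LinearEquiv.refl _ _)) fun p => ?_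
  simp only [adjoin_apply, LinearEquiv.prodCongr_apply, LinearEquiv.refl_apply,
    linearCombination_finsuppOptionEquiv]

/-- The monomials of a finite family in which every nonempty subfamily has a leaf have
sliding depth. -/
theorem IsVariableFamily.sliding [IsLocalRing R] (hx : IsVariableFamily x) {n : ℕ}
    (hR : DepthGE R R n) {ι : Type u} [Finite ι] {F : ι → Finset V} (hF : HasLeaves F) :
    Sliding n (Nat.card ι) (monomialForm x F) := by
  classical
  induction hq : Nat.card ι generalizing ι with
  | zero =>
    have := (Finite.card_eq_zero_iff).1 hq
    exact Sliding.of_subsingleton _ hR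
  | succ q ih =>
    have hcard : ∀ {κ : Type u} [Finite κ] (e : Option κ ≃ ι), Nat.card κ = q := fun {κ} _ e => by
      rw [← Nat.card_congr e, Finite.card_option] at hq
      omega
    have : Nonempty ι := by
      by_contra hι
      have := not_nonempty_iff.1 hι
      simp at hq
    obtain ⟨i, -, h⟩ := hF Set.univ Set.univ_nonempty
    rcases h with h | ⟨j, -, hji, h⟩
    -- Here the leaf is the only member: the remaining family is empty and regularity of the
    -- monomial holds vacuously.
    · refine sliding_monomialForm_equiv (Equiv.optionSubtypeNe i) F ?_
      rw [sliding_monomialForm_option]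
      refine Sliding.adjoin_of_regular
        (ih (hF.comp ⟨_, Function.Injective.comp (Equiv.injective _) (Option.some_injective _)⟩)
          (hcard (Equiv.optionSubtypeNe i))) (hx.monomialIn_regular _ _ fun v _ l => ?_)
      exact absurd (h.subset (Set.mem_univ l.1)) l.2
    -- Reindexing with the leaf at `none` and its joint at `some none`.
    · let e₁ := Equiv.optionSubtypeNe (⟨j, hji⟩ : {b // b ≠ i})
      let e := (Equiv.optionCongr e₁).trans (Equiv.optionSubtypeNe i)
      have he0 : e none = i := by simp [e]
      have he1 : e (some none) = j := by simp [e, e₁]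
      have hFe := hF.comp e.toEmbedding
      have hleaf : ∀ l, l ≠ none → ∀ v ∈ F (e none), v ∈ F (e l) → v ∈ F (e (some none)) := by
        intro l hl
        rw [he0, he1]
        exact h (e l) (Set.mem_univ _) fun hl' => hl (e.injective (hl'.trans he0.symm))
      refine sliding_monomialForm_equiv e F (hx.sliding_of_leaf _ hleaf ?_ ?_)
      · exact ih (hFe.comp ⟨some, Option.some_injective _⟩) (hcard e)
      · exact ih (hFe.contractLeaf hleaf) (hcard e)

end Monomials

/-! ### From simplicial trees to families with leaves -/

section Trees

variable {V : Type*}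

open Classical in
/-- The facets of a simplicial tree form a family in which every nonempty subfamily has a leaf. -/
theorem AbstractSimplicialComplex.IsTree.hasLeaves {Δ : AbstractSimplicialComplex V}
    (hΔ : Δ.IsTree) : HasLeaves fun F : Δ.facets => F.1 := by
  intro S hS
  -- The complex generated by the facets in `S`. Its facets are exactly the members of `S`, because
  -- facets of `Δ` are pairwise incomparable.
  let Γ : PreAbstractSimplicialComplex V :=
    { faces := {s | s.Nonempty ∧ ∃ F ∈ S, s ⊆ F.1}
      isRelLowerSet_faces := fun {s} hs => ⟨hs.1, fun t hts ht => by
        obtain ⟨_, F, hF, hsF⟩ := hs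
        exact ⟨ht, F, hF, hts.trans hsF⟩⟩ }
  have hmem : ∀ {s : Finset V}, s ∈ Γ ↔ s.Nonempty ∧ ∃ F ∈ S, s ⊆ F.1 := Iff.rfl
  have hface : ∀ F : Δ.facets, F ∈ S → F.1 ∈ Γ := fun F hF =>
    ⟨(Δ.isRelLowerSet_faces F.2.1).1, F, hF, subset_rfl⟩
  have hfacets : ∀ s, s ∈ Γ.facets ↔ ∃ F ∈ S, F.1 = s := by
    intro s
    constructor
    · intro hs
      obtain ⟨_, F, hF, hsF⟩ := hmem.1 hs.1
      exact ⟨F, hF, (hs.2 (hface F hF) hsF).antisymm hsF⟩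
    · rintro ⟨F, hF, rfl⟩
      refine ⟨hface F hF, fun t ht hFt => ?_⟩
      obtain ⟨_, G, hG, htG⟩ := hmem.1 ht
      exact htG.trans (F.2.2 G.2.1 (hFt.trans htG))
  have hsub : Γ.IsSubcomplex Δ.toPreAbstractSimplicialComplex := by
    intro s hs
    obtain ⟨F, _, rfl⟩ := (hfacets s).1 hs
    exact F.2
  have hne : Γ ≠ ⊥ := by
    intro h
    obtain ⟨F, hF⟩ := hS
    have := hface F hF
    rw [h] at this
    exact this
  obtain ⟨_, hF, hleaf⟩ := hΔ.2 Γ hsub hne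
  obtain ⟨F, hFS, rfl⟩ := (hfacets _).1 hF
  refine ⟨F, hFS, ?_⟩
  rcases hleaf with h | ⟨_, hG, hGF, h⟩
  · refine Or.inl (Set.eq_singleton_iff_unique_mem.2 ⟨hFS, fun G hG => Subtype.ext ?_⟩)
    have hG' : G.1 ∈ Γ.facets := (hfacets _).2 ⟨G, hG, rfl⟩
    rwa [h] at hG'
  · obtain ⟨G, hGS, rfl⟩ := (hfacets _).1 hG
    refine Or.inr ⟨G, hGS, fun hGF' => hGF (congrArg _ hGF'), fun l hl hlF v hvF hvl => ?_⟩
    exact (h l.1 ((hfacets _).2 ⟨l, hl, rfl⟩) (fun h => hlF (Subtype.ext h)) ⟨hvF, hvl⟩).2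

end Trees

theorem mainTheorem1 {V k : Type*} [Finite V] [Field k] (Δ : AbstractSimplicialComplex V)
    (hΔ : Δ.IsTree) :
    SlidingDepth
      ((facetIdeal k Δ).map (algebraMap (MvPolynomial V k) (LocalPolynomialRing V k)))
      (facetGenerators k Δ) := by
  constructor
  · rw [facetIdeal, Ideal.map_span, Set.image_image]
    congr 1
    ext r
    constructor
    · rintro ⟨F, rfl⟩
      exact ⟨F.1, F.2, rfl⟩
    · rintro ⟨F, hF, rfl⟩
      exact ⟨⟨F, hF⟩, rfl⟩
  · intro i
    have hgen : facetGenerators k Δ = fun F => monomialIn (localVar V k) F.1 :=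
      funext fun F => algebraMap_squarefreeMonomial k F.1
    have hsl := (isVariableFamily_localVar k).sliding (depthGE_localPolynomialRing k)
      hΔ.hasLeaves i
    have : IsNoetherianRing (LocalPolynomialRing V k) :=
      IsLocalization.isNoetherianRing (MvPolynomial.idealOfVars V k).primeCompl _ inferInstance
    obtain ⟨e⟩ := Koszul.nonempty_homology_equiv (facetGenerators k Δ) i
    rw [hgen] at e ⊢
    have hfin : Module.Finite (LocalPolynomialRing V k)
      ((koszulComplex fun F : Δ.facets => monomialIn (localVar V k) F.1).homology i) :=
      Module.Finite.equiv e.symm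
    have hdepth := (hsl.of_linearEquiv e.symm).le_moduleDepth
    rw [ringKrullDim_localPolynomialRing]
    -- Truncated subtraction is harmless: for `n + i < q` the inequality holds with depth bound
    -- zero.
    have h1 : (Nat.card V + i : ℕ) ≤
        (Nat.card V + i - Nat.card Δ.facets) + Nat.card Δ.facets := by omega
    calc ((Nat.card V : ℕ) : WithBot ℕ∞) + i = ((Nat.card V + i : ℕ) : WithBot ℕ∞) := by
          push_cast; rfl
      _ ≤ ((Nat.card V + i - Nat.card Δ.facets + Nat.card Δ.facets : ℕ) : WithBot ℕ∞) := by
          exact_mod_cast h1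
      _ = ((Nat.card V + i - Nat.card Δ.facets : ℕ) : WithBot ℕ∞) + (Nat.card Δ.facets : ℕ) := by
          push_cast; rfl
      _ ≤ _ := by
          gcongr
          exact WithBot.coe_le_coe.2 hdepth
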